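/- Let $k$ be a field of any characteristic, and consider the following three cases. (a) $G_1=\mathrm{GL}_3(k)\times\mathrm{GL}_3(k)$ acts on $Y=\mathrm M_3(k)$ by $(g_{11},g_{12})\cdot y=g_{11}\,y\,{}^tg_{12}$. (b) $F_0/k$ is a quadratic Galois extension, $\sigma$ the generator of $\mathrm{Gal}(F_0/k)$, and $G_1=\mathrm{GL}_3(F_0)$ acts on $Y=\mathrm H_3(F_0)=\{y\in\mathrm M_3(F_0)\mid {}^t(y^\sigma)=y\}$ by $g\cdot y=g\,y\,{}^t(g^\sigma)$. (c) $B$ is a quaternion algebra over $k$ (that is, $B$ has a $k$-basis $1,i,j,ij$ with $i^2=a+bi$, $j^2=c$, $ji=(b-i)j$ for some $a,b,c\in k$ with $c(b^2+4a)\neq0$) with canonical involution $*$; $\iota$ is the conjugate transpose $(y_{ij})\mapsto(y_{ji}^*)$ on $\mathrm M_3(B)$, and $G_1=\mathrm{GL}_3(B)$ acts on $Y=\mathrm H_3(B)=\{y\in \mathrm M_3(B)\mid y^\iota=y,\ y_{11},y_{22},y_{33}\in k\}$ by $g\cdot y=g\,y\,g^\iota$ (the condition on the diagonal is automatic if $\operatorname{char}k\ne2$).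 Put $G(k)=G_1\times\mathrm{GL}_2(k)$ and $V=Y\oplus Y$. Write $x=(x_1,x_2)\in V$ as $x(v)=x_1v_1+x_2v_2$ with $v=(v_1,v_2)$ a row vector of variables, and let $G(k)$ act on $V$ by $((g_1,g_2)\cdot x)(v)=g_1\cdot x(vg_2)$. Let $F_x(v)$ be the binary cubic form $\det x(v)$ in cases (a) and (b), and $\mathrm{Pfaff}_3(x(v))$ in case (c), where $\mathrm{Pfaff}_3$ is the cubic form on $\mathrm H_3(B)$ whose square is the reduced norm of $\mathrm M_3(B)$ and whose value at the identity matrix is $1$. Let $P(x)$ be the discriminant of $F_x$. For $x\in V$ with $P(x)\ne0$ put $L_x=\Gamma(Z_x,\mathcal O_{Z_x})$ with $Z_x=\mathrm{Proj}\,k[v_1,v_2]/(F_x(v))$, a $k$-algebra, and let $$V^{(2)}=\{x\in V\mid P(x)\neq0,\ L_x\cong k\times F\text{ for some separable quadratic field extension }F/k\}.$$ Let $\mathrm P_{1,2}(A)\subset\mathrm{GL}_3(A)$ be the subgroup of matrices with first row $(*,0,0)$ and $\mathrm B_2(k)\subset\mathrm{GL}_2(k)$ the lower triangular subgroup. Let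 $P(k)\subset G(k)$ be $\mathrm P_{1,2}(k)\times\mathrm P_{1,2}(k)\times\mathrm B_2(k)$, $\mathrm P_{1,2}(F_0)\times\mathrm B_2(k)$, $\mathrm P_{1,2}(B)\times\mathrm B_2(k)$ in cases (a), (b), (c) respectively. Let $Z\subset Y$ be the subspace of matrices whose first row and first column vanish, $W=Z\oplus Y\subset V$, and $W^{(2)}=W\cap V^{(2)}$. **Proposition.** In each of the cases (a), (b), (c), the subspace $W$ is $P(k)$-invariant, and $$V^{(2)}=G(k)\times_{P(k)}W^{(2)},$$ that is: $W^{(2)}$ is $P(k)$-invariant, and $[g,w]\mapsto g\cdot w$ is a bijection onto $V^{(2)}$ from the quotient of $G(k)\times W^{(2)}$ by the relation $(gp^{-1},p\cdot w)\sim(g,w)$, $p\in P(k)$. In particular, every $G(k)$-orbit in $V^{(2)}$ meets $W$, and any two points of $W^{(2)}$ that are $G(k)$-equivalent are $P(k)$-equivalent. -/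

import Mathlib

open MvPolynomial

noncomputable section

namespace CubicOrbits

universe u v

/-! ### Quotients of graded algebras by homogeneous ideals -/

section QuotientGrading

variable {k A : Type*} [CommRing k] [CommRing A] [Algebra k A]
  (𝒜 : ℕ → Submodule k A) (I : Ideal A)

/-- The images in `A ⧸ I` of the graded pieces of `A`. -/
def quotientGrading (n : ℕ) : Submodule k (A ⧸ I) :=
  (𝒜 n).map (Ideal.Quotient.mkₐ k I).toLinearMap

variable [GradedAlgebra 𝒜]

/-- Decompose in `A`, then map each component to `A ⧸ I`. -/
def preDecompose : A →ₗ[k] DirectSum ℕ fun n => ↥(quotientGrading 𝒜 I n) :=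
  (DirectSum.lmap fun n =>
    ((Ideal.Quotient.mkₐ k I).toLinearMap.restrict
      (p := 𝒜 n) (q := quotientGrading 𝒜 I n) fun _ hx => Submodule.mem_map_of_mem hx)) ∘ₗ
    (DirectSum.decomposeLinearEquiv 𝒜).toLinearMap

lemma preDecompose_apply (p : A) (n : ℕ) :
    ((preDecompose 𝒜 I p n : quotientGrading 𝒜 I n) : A ⧸ I) =
      Ideal.Quotient.mk I (DirectSum.decompose 𝒜 p n : A) := by
  simp only [preDecompose, LinearMap.comp_apply, DirectSum.lmap_apply]
  rfl

lemma preDecompose_of_mem {p : A} {n : ℕ} (hp : p ∈ 𝒜 n) :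
    preDecompose 𝒜 I p = DirectSum.of (fun n => ↥(quotientGrading 𝒜 I n)) n
      ⟨Ideal.Quotient.mk I p, Submodule.mem_map_of_mem hp⟩ := by
  refine DFinsupp.ext fun m => Subtype.ext ?_
  refine (preDecompose_apply 𝒜 I p m).trans ?_
  by_cases h : n = m
  · subst h
    simp [DirectSum.decompose_of_mem_same _ hp]
  · rw [DirectSum.decompose_of_mem_ne _ hp h, DirectSum.of_eq_of_ne _ _ _ (Ne.symm h)]
    simp

variable {I}

lemma preDecompose_eq_zero (hI : I.IsHomogeneous 𝒜) (p : A) (hp : p ∈ I) : preDecompose 𝒜 I p = 0 := by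
  refine DFinsupp.ext fun n => Subtype.ext ?_
  refine (preDecompose_apply 𝒜 I p n).trans ?_
  exact Ideal.Quotient.eq_zero_iff_mem.2 (hI n hp)

variable (hI : I.IsHomogeneous 𝒜)

/-- The decomposition of `A ⧸ I` into graded pieces. -/
def quotientDecompose : (A ⧸ I) →+ DirectSum ℕ fun n => ↥(quotientGrading 𝒜 I n) :=
  QuotientAddGroup.lift I.toAddSubgroup (preDecompose 𝒜 I).toAddMonoidHom
    fun p hp => preDecompose_eq_zero 𝒜 hI p hp

lemma quotientDecompose_mk (p : A) :
    quotientDecompose 𝒜 hI (Ideal.Quotient.mk I p) = preDecompose 𝒜 I p := rfl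

/-- The quotient of a graded algebra by a homogeneous ideal is graded. -/
@[reducible] def quotientGradedAlgebra : GradedAlgebra (quotientGrading 𝒜 I) where
  one_mem := ⟨1, SetLike.GradedOne.one_mem, rfl⟩
  mul_mem := by
    rintro i j _ _ ⟨p, hp, rfl⟩ ⟨q, hq, rfl⟩
    exact ⟨p * q, SetLike.GradedMul.mul_mem hp hq, rfl⟩
  decompose' := quotientDecompose 𝒜 hI
  left_inv := by
    intro x
    obtain ⟨p, rfl⟩ := Ideal.Quotient.mk_surjective x
    induction p using DirectSum.Decomposition.inductionOn 𝒜 with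
    | zero => simp
    | homogeneous m =>
      rw [quotientDecompose_mk, preDecompose_of_mem 𝒜 I m.2, DirectSum.coeAddMonoidHom_of]
    | add p q hp hq => simp only [map_add, hp, hq]
  right_inv := by
    intro x
    induction x using DirectSum.induction_on with
    | zero => simp
    | of n y =>
      obtain ⟨_, p, hp, rfl⟩ := y
      rw [DirectSum.coeAddMonoidHom_of]
      exact (quotientDecompose_mk 𝒜 hI p).trans (preDecompose_of_mem 𝒜 I hp)
    | add p q hp hq => simp only [map_add, hp, hq]

end QuotientGrading

/-! ### Binary cubic forms and the scheme `Proj k[v₁, v₂] / (f)` -/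

section BinaryCubic

attribute [local instance] MvPolynomial.gradedAlgebra

/-- Binary cubic forms over `k`, in the variables `v₁ = X 0` and `v₂ = X 1`. -/
abbrev BinaryCubic (k : Type u) [Field k] : Type u :=
  ↥(homogeneousSubmodule (Fin 2) k 3)

variable {k : Type u} [Field k]

/-- The discriminant of the binary cubic form `a v₁³ + b v₁² v₂ + c v₁ v₂² + d v₂³`, that is
`b² c² - 4 a c³ - 4 b³ d - 27 a² d² + 18 a b c d`. -/
def disc (f : BinaryCubic k) : k :=
  Cubic.discr
    { a := coeff (Finsupp.single 0 3) f.1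
      b := coeff (Finsupp.single 0 2 + Finsupp.single 1 1) f.1
      c := coeff (Finsupp.single 0 1 + Finsupp.single 1 2) f.1
      d := coeff (Finsupp.single 1 3) f.1 }

/-- The grading by degree of the homogeneous coordinate ring `k[v₁, v₂] / (f)`. -/
def grading (f : BinaryCubic k) :
    ℕ → Submodule k (MvPolynomial (Fin 2) k ⧸ Ideal.span {f.1}) :=
  quotientGrading (homogeneousSubmodule (Fin 2) k) (Ideal.span {f.1})

lemma isHomogeneous_span (f : BinaryCubic k) :
    (Ideal.span {f.1}).IsHomogeneous (homogeneousSubmodule (Fin 2) k) := by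
  refine Ideal.homogeneous_span _ _ ?_
  rintro x rfl
  exact ⟨3, f.2⟩

instance (f : BinaryCubic k) : GradedAlgebra (grading f) :=
  quotientGradedAlgebra (homogeneousSubmodule (Fin 2) k) (isHomogeneous_span f)

open AlgebraicGeometry CategoryTheory in
/-- `Z_f = Proj k[v₁, v₂] / (f)`. -/
def zeroScheme (f : BinaryCubic k) : Scheme.{u} := Proj (grading f)

open AlgebraicGeometry CategoryTheory in
/-- The structure morphism `Z_f ⟶ Spec k`. -/
def zeroSchemeHom (f : BinaryCubic k) : zeroScheme f ⟶ Spec (.of k) :=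
  Proj.toSpecZero (grading f) ≫ Spec.map (CommRingCat.ofHom (algebraMap k (grading f 0)))

open AlgebraicGeometry CategoryTheory in
/-- `L_f = Γ(Z_f, 𝒪)`. -/
def globalSections (f : BinaryCubic k) : Type u := Γ(zeroScheme f, ⊤)

open AlgebraicGeometry CategoryTheory in
instance (f : BinaryCubic k) : CommRing (globalSections f) :=
  inferInstanceAs (CommRing Γ(zeroScheme f, ⊤))

open AlgebraicGeometry CategoryTheory in
/-- The `k`-algebra structure of `Γ(Z_f, 𝒪)` given by the structure morphism `Z_f ⟶ Spec k`. -/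
instance (f : BinaryCubic k) : Algebra k (globalSections f) :=
  RingHom.toAlgebra ((Scheme.ΓSpecIso (.of k)).inv ≫ (zeroSchemeHom f).appTop).hom

/-- The `k`-algebra `L` is isomorphic to `k × F` for a separable quadratic field extension
`F / k`. -/
def IsTypeOneTwo (k : Type u) [Field k] (L : Type u) [CommRing L] [Algebra k L] : Prop :=
  ∃ (F : Type u) (_ : Field F) (_ : Algebra k F),
    Module.finrank k F = 2 ∧ Algebra.IsSeparable k F ∧ Nonempty (L ≃ₐ[k] k × F)

end BinaryCubic

/-! ### Contracted products -/

section Contracted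

variable {G X : Type*} [Group G] [MulAction G X]

/-- The relation `(g p⁻¹, p s) ~ (g, s)` for `p ∈ P` on `G × S`, where `S` is `P`-stable. -/
def contractedSetoid (P : Subgroup G) (S : Set X) : Setoid (G × S) where
  r a b := ∃ p ∈ P, b.1 = a.1 * p⁻¹ ∧ (b.2 : X) = p • (a.2 : X)
  iseqv :=
    { refl := fun a => ⟨1, P.one_mem, by simp, by simp⟩
      symm := by
        rintro a b ⟨p, hp, h1, h2⟩
        exact ⟨p⁻¹, P.inv_mem hp, by simp [h1], by simp [h2]⟩
      trans := by
        rintro a b c ⟨p, hp, h1, h2⟩ ⟨q, hq, h3, h4⟩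
        exact ⟨q * p, P.mul_mem hq hp, by simp [h1, h3, mul_assoc], by simp [h2, h4, mul_smul]⟩ }

/-- The contracted product `G ×_P S`. -/
def ContractedProduct (P : Subgroup G) (S : Set X) : Type _ :=
  Quotient (contractedSetoid P S)

/-- The map `G ×_P S → X`, `[g, s] ↦ g s`. -/
def contractedMap (P : Subgroup G) (S : Set X) : ContractedProduct P S → X :=
  Quotient.lift (fun a : G × S => a.1 • (a.2 : X)) <| by
    rintro a b ⟨p, -, h1, h2⟩
    simp [h1, h2, mul_smul]

/-- `T = G ×_P S`: the set `S` is `P`-stable, and `[g, s] ↦ g s` is a bijection from the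
contracted product `G ×_P S` onto `T`. -/
def EqContractedProduct (T : Set X) (P : Subgroup G) (S : Set X) : Prop :=
  (∀ p ∈ P, ∀ s ∈ S, p • s ∈ S) ∧ Set.BijOn (contractedMap P S) Set.univ T

end Contracted

/-! ### Pairs: the representation `V = Y ⊕ Y` of `G = G₁ × GL₂(k)` -/

section Pairs

/-- `V = Y ⊕ Y`; the pair `(x₁, x₂)` stands for `x(v) = x₁ v₁ + x₂ v₂`. -/
def Pair (Y : Type*) : Type _ := Y × Y

variable {k : Type u} [Field k] {Y : Type v} [AddCommGroup Y] [Module k Y]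

instance : AddCommGroup (Pair Y) := inferInstanceAs (AddCommGroup (Y × Y))

instance : Module k (Pair Y) := inferInstanceAs (Module k (Y × Y))

/-- The action `(g · x)(v) = g₁ · x(v g₂)`, that is
`(g₁, (a b; c d)) · (x₁, x₂) = (g₁ · (a x₁ + b x₂), g₁ · (c x₁ + d x₂))`. -/
instance {G₁ : Type*} [Group G₁] [DistribMulAction G₁ Y] [SMulCommClass G₁ k Y] :
    MulAction (G₁ × Matrix.GeneralLinearGroup (Fin 2) k) (Pair Y) where
  smul g x :=
    (g.1 • (g.2.1 0 0 • x.1 + g.2.1 0 1 • x.2), g.1 • (g.2.1 1 0 • x.1 + g.2.1 1 1 • x.2))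
  one_smul x := by
    refine Prod.ext ?_ ?_
    · change (1 : G₁) • ((1 : Matrix (Fin 2) (Fin 2) k) 0 0 • x.1 +
        (1 : Matrix (Fin 2) (Fin 2) k) 0 1 • x.2) = x.1
      simp
    · change (1 : G₁) • ((1 : Matrix (Fin 2) (Fin 2) k) 1 0 • x.1 +
        (1 : Matrix (Fin 2) (Fin 2) k) 1 1 • x.2) = x.2
      simp
  mul_smul g h x := by
    have comm : ∀ (c : k) (y : Y), c • h.1 • y = h.1 • c • y := fun c y =>
      (smul_comm h.1 c y).symm
    refine Prod.ext ?_ ?_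
    · change (g.1 * h.1) • ((g.2.1 * h.2.1) 0 0 • x.1 + (g.2.1 * h.2.1) 0 1 • x.2) =
        g.1 • (g.2.1 0 0 • h.1 • (h.2.1 0 0 • x.1 + h.2.1 0 1 • x.2) +
          g.2.1 0 1 • h.1 • (h.2.1 1 0 • x.1 + h.2.1 1 1 • x.2))
      simp only [Matrix.mul_apply, Fin.sum_univ_two, mul_smul, smul_add, add_smul,
        comm]
      abel
    · change (g.1 * h.1) • ((g.2.1 * h.2.1) 1 0 • x.1 + (g.2.1 * h.2.1) 1 1 • x.2) =
        g.1 • (g.2.1 1 0 • h.1 • (h.2.1 0 0 • x.1 + h.2.1 0 1 • x.2) +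
          g.2.1 1 1 • h.1 • (h.2.1 1 0 • x.1 + h.2.1 1 1 • x.2))
      simp only [Matrix.mul_apply, Fin.sum_univ_two, mul_smul, smul_add, add_smul,
        comm]
      abel

/-- For a covariant `x ↦ F_x`: the set of all `x` with `P(x) = disc(F_x) ≠ 0` such that
`L_x = Γ(Proj k[v₁, v₂] / (F_x), 𝒪)` is isomorphic to `k × F` for a quadratic field `F`. -/
def typeOneTwoSet (form : Pair Y → BinaryCubic k) : Set (Pair Y) :=
  {x | disc (form x) ≠ 0 ∧ IsTypeOneTwo k (globalSections (form x))}

/-- `Z ⊕ Y ⊆ Y ⊕ Y`. -/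
def firstIn (Z : Submodule k Y) : Submodule k (Pair Y) :=
  (Z.prod ⊤ : Submodule k (Y × Y))

end Pairs

/-! ### The groups -/

section Groups

/-- `GL₃(A)` for a possibly noncommutative ring `A`. -/
abbrev GL3 (A : Type*) [Ring A] : Type _ := (Matrix (Fin 3) (Fin 3) A)ˣ

/-- `P_{1,2}(A)`: the elements of `GL₃(A)` with first row `(*, 0, 0)`. -/
def P12 (A : Type*) [Ring A] [IsDedekindFiniteMonoid A] : Subgroup (GL3 A) where
  carrier := {g | g.1 0 1 = 0 ∧ g.1 0 2 = 0}
  one_mem' := by simp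
  mul_mem' := by
    rintro g h ⟨g1, g2⟩ ⟨h1, h2⟩
    simp [Matrix.mul_apply, Fin.sum_univ_three, g1, g2, h1, h2]
  inv_mem' := by
    rintro g ⟨g1, g2⟩
    have e : ∀ j, g.1 0 0 * g⁻¹.1 0 j = (1 : Matrix (Fin 3) (Fin 3) A) 0 j := by
      intro j
      have h : (g.1 * g⁻¹.1) 0 j = (1 : Matrix (Fin 3) (Fin 3) A) 0 j :=
        congrFun (congrFun g.mul_inv 0) j
      simpa [Matrix.mul_apply, Fin.sum_univ_three, g1, g2] using h
    have e0 : g⁻¹.1 0 0 * g.1 0 0 = 1 := mul_eq_one_symm (by simpa using e 0)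
    have key : ∀ j, j ≠ 0 → g⁻¹.1 0 j = 0 := by
      intro j hj
      have := e j
      rw [Matrix.one_apply_ne hj.symm] at this
      calc g⁻¹.1 0 j = g⁻¹.1 0 0 * g.1 0 0 * g⁻¹.1 0 j := by rw [e0, one_mul]
        _ = 0 := by rw [mul_assoc, this, mul_zero]
    exact ⟨key 1 (by decide), key 2 (by decide)⟩

/-- `B₂(k)`: the lower triangular matrices in `GL₂(k)`. -/
def B2 (k : Type*) [Field k] : Subgroup (Matrix.GeneralLinearGroup (Fin 2) k) where
  carrier := {g | g.1 0 1 = 0}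
  one_mem' := by simp
  mul_mem' := by
    intro g h g1 h1
    simp only [Set.mem_ofPred_eq] at g1 h1 ⊢
    simp [Matrix.mul_apply, Fin.sum_univ_two, g1, h1]
  inv_mem' := by
    intro g g1
    simp only [Set.mem_ofPred_eq] at g1 ⊢
    simp [Matrix.inv_def, Matrix.adjugate_fin_two, g1]

end Groups

/-! ### Case (a): `Y = M₃(k)`, `G₁ = GL₃(k) × GL₃(k)` -/

section CaseA

variable (k : Type u) [Field k]

/-- `Y = M₃(k)`. -/
abbrev YA : Type u := Matrix (Fin 3) (Fin 3) k

/-- `(g₁₁, g₁₂) · y = g₁₁ y ᵗg₁₂`. -/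
instance : DistribMulAction (GL3 k × GL3 k) (YA k) where
  smul g y := g.1.1 * y * g.2.1.transpose
  one_smul y := by
    change (1 : YA k) * y * (1 : YA k).transpose = y
    simp
  mul_smul g h y := by
    change (g.1.1 * h.1.1) * y * (g.2.1 * h.2.1).transpose =
      g.1.1 * (h.1.1 * y * h.2.1.transpose) * g.2.1.transpose
    simp only [Matrix.transpose_mul, Matrix.mul_assoc]
  smul_zero g := by
    change g.1.1 * 0 * g.2.1.transpose = 0
    simp
  smul_add g y z := by
    change g.1.1 * (y + z) * g.2.1.transpose =
      g.1.1 * y * g.2.1.transpose + g.1.1 * z * g.2.1.transpose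
    simp only [mul_add, add_mul]

instance : SMulCommClass (GL3 k × GL3 k) k (YA k) where
  smul_comm g c y := by
    change g.1.1 * (c • y) * g.2.1.transpose = c • (g.1.1 * y * g.2.1.transpose)
    simp

/-- `G(k)` in case (a). -/
abbrev GA : Type u := (GL3 k × GL3 k) × Matrix.GeneralLinearGroup (Fin 2) k

/-- `P(k) = P_{1,2}(k) × P_{1,2}(k) × B₂(k)`. -/
def PA : Subgroup (GA k) := ((P12 k).prod (P12 k)).prod (B2 k)

/-- The matrices in `M₃(k)` with vanishing first row and first column. -/
def ZA : Submodule k (YA k) where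
  carrier := {y | ∀ i, y 0 i = 0 ∧ y i 0 = 0}
  zero_mem' := by simp
  add_mem' := by
    intro y z hy hz i
    simp [hy i, hz i]
  smul_mem' := by
    intro c y hy i
    simp [hy i]

variable {k}

/-- The matrix `x(v) = x₁ v₁ + x₂ v₂` of linear forms. -/
def linearMatrix {A : Type*} [CommRing A] (x₁ x₂ : Matrix (Fin 3) (Fin 3) A) :
    Matrix (Fin 3) (Fin 3) (MvPolynomial (Fin 2) A) :=
  Matrix.of fun i j => C (x₁ i j) * X 0 + C (x₂ i j) * X 1

lemma isHomogeneous_det_linearMatrix {A : Type*} [CommRing A]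
    (x₁ x₂ : Matrix (Fin 3) (Fin 3) A) : (linearMatrix x₁ x₂).det.IsHomogeneous 3 := by
  have h : ∀ i j, (linearMatrix x₁ x₂ i j).IsHomogeneous 1 := fun i j =>
    (isHomogeneous_C_mul_X _ _).add (isHomogeneous_C_mul_X _ _)
  have h3 : ∀ i j i' j' i'' j'', (linearMatrix x₁ x₂ i j * linearMatrix x₁ x₂ i' j' *
      linearMatrix x₁ x₂ i'' j'').IsHomogeneous 3 := fun i j i' j' i'' j'' =>
    ((h i j).mul (h i' j')).mul (h i'' j'')
  rw [Matrix.det_fin_three]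
  exact (((((h3 _ _ _ _ _ _).sub (h3 _ _ _ _ _ _)).sub (h3 _ _ _ _ _ _)).add
    (h3 _ _ _ _ _ _)).add (h3 _ _ _ _ _ _)).sub (h3 _ _ _ _ _ _)

/-- `F_x(v) = det(x(v))`. -/
def formA (x : Pair (YA k)) : BinaryCubic k :=
  ⟨(linearMatrix x.1 x.2).det, isHomogeneous_det_linearMatrix x.1 x.2⟩

variable (k)

/-- `V⁽²⁾` in case (a). -/
def V2A : Set (Pair (YA k)) := typeOneTwoSet formA

/-- `W = Z ⊕ Y` in case (a). -/
def WA : Submodule k (Pair (YA k)) := firstIn (ZA k)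

/-- `W⁽²⁾ = W ∩ V⁽²⁾` in case (a). -/
def W2A : Set (Pair (YA k)) := WA k ∩ V2A k

end CaseA

/-! ### Case (b): `Y = H₃(F)`, `G₁ = GL₃(F)` for a quadratic extension `F / k` -/

section CaseB

variable {k : Type u} [Field k] {F : Type v} [Field F] [Algebra k F] (σ : F ≃ₐ[k] F)

/-- `ᵗ(y^σ)`. -/
def conjT (y : Matrix (Fin 3) (Fin 3) F) : Matrix (Fin 3) (Fin 3) F :=
  (y.map σ).transpose

lemma conjT_apply (y : Matrix (Fin 3) (Fin 3) F) (i j : Fin 3) : conjT σ y i j = σ (y j i) := rfl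

lemma conjT_mul (y z : Matrix (Fin 3) (Fin 3) F) :
    conjT σ (y * z) = conjT σ z * conjT σ y := by
  simp [conjT, Matrix.map_mul, Matrix.transpose_mul]

lemma conjT_add (y z : Matrix (Fin 3) (Fin 3) F) :
    conjT σ (y + z) = conjT σ y + conjT σ z := by
  ext i j
  simp [conjT_apply]

lemma conjT_smul (c : k) (y : Matrix (Fin 3) (Fin 3) F) : conjT σ (c • y) = c • conjT σ y := by
  ext i j
  simp [conjT_apply]

lemma conjT_one : conjT σ (1 : Matrix (Fin 3) (Fin 3) F) = 1 := by
  simp [conjT]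

/-- `H₃(F) = {y ∈ M₃(F) | ᵗ(y^σ) = y}` for an involution `σ` of `F / k`. -/
def YB : Submodule k (Matrix (Fin 3) (Fin 3) F) where
  carrier := {y | conjT σ y = y}
  zero_mem' := by
    ext i j
    simp [conjT_apply]
  add_mem' := by
    intro y z hy hz
    simp only [Set.mem_ofPred_eq] at hy hz ⊢
    rw [conjT_add, hy, hz]
  smul_mem' := by
    intro c y hy
    simp only [Set.mem_ofPred_eq] at hy ⊢
    rw [conjT_smul, hy]

/-- In case (b), `σ` is the generator of the Galois group of a quadratic extension `F / k`. -/
class IsQuadraticConj : Prop where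
  finrank_eq : Module.finrank k F = 2
  isGalois : IsGalois k F
  generates : ∀ τ : F ≃ₐ[k] F, τ ∈ Subgroup.zpowers σ

variable [hσ : IsQuadraticConj σ]

lemma conj_conj (a : F) : σ (σ a) = a := by
  have := hσ.isGalois
  have : FiniteDimensional k F := FiniteDimensional.of_finrank_pos (by rw [hσ.finrank_eq]; omega)
  have h : Nat.card (F ≃ₐ[k] F) = 2 := by
    rw [IsGalois.card_aut_eq_finrank, hσ.finrank_eq]
  have h2 : σ ^ 2 = 1 := h ▸ pow_card_eq_one'
  have h3 := congrArg (fun τ : F ≃ₐ[k] F => τ a) h2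
  simpa [pow_two] using h3

lemma mem_range_of_conj_eq {a : F} (h : σ a = a) : a ∈ Set.range (algebraMap k F) := by
  have := hσ.isGalois
  have : FiniteDimensional k F := FiniteDimensional.of_finrank_pos (by rw [hσ.finrank_eq]; omega)
  refine (IsGalois.mem_range_algebraMap_iff_fixed a).2 fun τ => ?_
  have hs : σ ∈ MulAction.stabilizer (F ≃ₐ[k] F) a := h
  exact (Subgroup.zpowers_le.2 hs) (hσ.generates τ)

lemma conjT_conjT (y : Matrix (Fin 3) (Fin 3) F) : conjT σ (conjT σ y) = y := by
  ext i j
  simp [conjT_apply, conj_conj]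

/-- `g · y = g y ᵗ(g^σ)`. -/
instance : DistribMulAction (GL3 F) (YB σ) where
  smul g y := ⟨g.1 * y.1 * conjT σ g.1, by
    have hy : conjT σ y.1 = y.1 := y.2
    change conjT σ _ = _
    rw [conjT_mul, conjT_mul, conjT_conjT, hy, Matrix.mul_assoc]⟩
  one_smul y := by
    refine Subtype.ext ?_
    change (1 : Matrix (Fin 3) (Fin 3) F) * y.1 * conjT σ 1 = y.1
    simp [conjT_one]
  mul_smul g h y := by
    refine Subtype.ext ?_
    change (g.1 * h.1) * y.1 * conjT σ (g.1 * h.1) =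
      g.1 * (h.1 * y.1 * conjT σ h.1) * conjT σ g.1
    simp only [conjT_mul, Matrix.mul_assoc]
  smul_zero g := by
    refine Subtype.ext ?_
    change g.1 * 0 * conjT σ g.1 = 0
    simp
  smul_add g y z := by
    refine Subtype.ext ?_
    change g.1 * (y.1 + z.1) * conjT σ g.1 = g.1 * y.1 * conjT σ g.1 + g.1 * z.1 * conjT σ g.1
    simp only [mul_add, add_mul]

instance : SMulCommClass (GL3 F) k (YB σ) where
  smul_comm g c y := by
    refine Subtype.ext ?_
    change g.1 * (c • y.1) * conjT σ g.1 = c • (g.1 * y.1 * conjT σ g.1)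
    simp

/-- `det(x(v))` has coefficients in `k`. -/
lemma exists_formB (x : Pair (YB σ)) : ∃ f : BinaryCubic k,
    MvPolynomial.map (algebraMap k F) f.1 = (linearMatrix x.1.1 x.2.1).det := by
  have h1 : ∀ i j, σ (x.1.1 i j) = x.1.1 j i := fun i j =>
    congrFun (congrFun (show conjT σ x.1.1 = x.1.1 from x.1.2) j) i
  have h2 : ∀ i j, σ (x.2.1 i j) = x.2.1 j i := fun i j =>
    congrFun (congrFun (show conjT σ x.2.1 = x.2.1 from x.2.2) j) i
  have hdet : MvPolynomial.map (σ : F →+* F) (linearMatrix x.1.1 x.2.1).det =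
      (linearMatrix x.1.1 x.2.1).det := by
    rw [RingHom.map_det, ← Matrix.det_transpose]
    congr 1
    ext1 i j
    simp [linearMatrix, h1, h2]
  obtain ⟨f, hf⟩ : (linearMatrix x.1.1 x.2.1).det ∈
      Set.range (MvPolynomial.map (σ := Fin 2) (algebraMap k F)) := by
    refine mem_range_map_iff_coeffs_subset.2 ?_
    intro c hc
    obtain ⟨m, -, rfl⟩ := mem_coeffs_iff.1 hc
    refine mem_range_of_conj_eq σ ?_
    have := congrArg (coeff m) hdet
    simpa [coeff_map] using this
  refine ⟨⟨f, ?_⟩, hf⟩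
  refine IsHomogeneous.of_map (algebraMap k F).injective ?_
  rw [hf]
  exact isHomogeneous_det_linearMatrix _ _

/-- `F_x(v) = det(x(v))`, as a form over `k`. -/
def formB (x : Pair (YB σ)) : BinaryCubic k := (exists_formB σ x).choose

lemma map_formB (x : Pair (YB σ)) :
    MvPolynomial.map (algebraMap k F) (formB σ x).1 = (linearMatrix x.1.1 x.2.1).det :=
  (exists_formB σ x).choose_spec

variable (k F) in
/-- `G(k)` in case (b). -/
abbrev GB : Type (max u v) := GL3 F × Matrix.GeneralLinearGroup (Fin 2) k

variable (k F) in
/-- `P(k) = P_{1,2}(F) × B₂(k)`. -/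
def PB : Subgroup (GB k F) := (P12 F).prod (B2 k)

/-- The matrices in `H₃(F)` with vanishing first row and first column. -/
def ZB : Submodule k (YB σ) where
  carrier := {y | ∀ i, y.1 0 i = 0 ∧ y.1 i 0 = 0}
  zero_mem' := by simp
  add_mem' := by
    intro y z hy hz i
    simp [hy i, hz i]
  smul_mem' := by
    intro c y hy i
    simp [hy i]

/-- `V⁽²⁾` in case (b). -/
def V2B : Set (Pair (YB σ)) := typeOneTwoSet (formB σ)

/-- `W = Z ⊕ Y` in case (b). -/
def WB : Submodule k (Pair (YB σ)) := firstIn (ZB σ)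

/-- `W⁽²⁾ = W ∩ V⁽²⁾` in case (b). -/
def W2B : Set (Pair (YB σ)) := WB σ ∩ V2B σ

end CaseB

/-! ### Case (c): `Y = H₃(B)`, `G₁ = GL₃(B)` for a quaternion algebra `B / k`

The quaternion algebra with parameters `a b c` is Mathlib's `ℍ[k,a,b,c]`: it has the basis
`1, i, j, i j` with `i² = a + b i`, `j² = c`, `j i = (b - i) j`, and `star` is its canonical
involution. It is central simple if and only if `c ≠ 0` and `b² + 4 a ≠ 0`, and over a field of
any characteristic every central simple algebra of dimension four is of this form. -/

section CaseC

open Quaternion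

variable {R : Type*} [CommRing R] {a b c : R}

/-- The reduced norm `q q*` on a quaternion algebra. -/
def qNorm (q : ℍ[R,a,b,c]) : R := (q * star q).re

/-- The reduced trace `q + q*` on a quaternion algebra. -/
def qTrace (q : ℍ[R,a,b,c]) : R := (q + star q).re

/-- The Pfaffian `Pfaff₃` on Hermitian matrices
`(r₁ z y*; z* r₂ x; y x* r₃)` with scalars `r₁, r₂, r₃` on the diagonal: it is
`r₁ r₂ r₃ - r₁ N(x) - r₂ N(y) - r₃ N(z) + T(z x y)`. This is the cubic form with value `1` at the
identity matrix whose square is the reduced norm. -/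
def pfaff3 (y : Matrix (Fin 3) (Fin 3) ℍ[R,a,b,c]) : R :=
  (y 0 0).re * (y 1 1).re * (y 2 2).re
    - (y 0 0).re * qNorm (y 1 2) - (y 1 1).re * qNorm (y 2 0) - (y 2 2).re * qNorm (y 0 1)
    + qTrace (y 0 1 * y 1 2 * y 2 0)

variable {k : Type u} [Field k] (a b c : k)

lemma star_mem_scalars {q : ℍ[k,a,b,c]} : q + star q ∈ Set.range (algebraMap k ℍ[k,a,b,c]) :=
  ⟨2 * q.re + b * q.imI, (QuaternionAlgebra.self_add_star' q).symm⟩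

/-- `H₃(B)`: the matrices `y ∈ M₃(B)` that are equal to their conjugate transpose and have their
diagonal entries in `k`. The condition on the diagonal is automatic in characteristic other than
two; in characteristic two it is part of the definition of Hermitian forms. -/
def YC : Submodule k (Matrix (Fin 3) (Fin 3) ℍ[k,a,b,c]) where
  carrier := {y | y.conjTranspose = y ∧ ∀ i, y i i ∈ Set.range (algebraMap k ℍ[k,a,b,c])}
  zero_mem' := ⟨by simp, fun i => ⟨0, by simp⟩⟩
  add_mem' := by
    rintro y z ⟨hy, hy'⟩ ⟨hz, hz'⟩
    refine ⟨by rw [Matrix.conjTranspose_add, hy, hz], fun i => ?_⟩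
    obtain ⟨r, hr⟩ := hy' i
    obtain ⟨s, hs⟩ := hz' i
    exact ⟨r + s, by rw [map_add, hr, hs]; rfl⟩
  smul_mem' := by
    rintro r y ⟨hy, hy'⟩
    refine ⟨?_, fun i => ?_⟩
    · conv_rhs => rw [← hy]
      ext1 i j
      simp [Matrix.conjTranspose_apply]
    · obtain ⟨s, hs⟩ := hy' i
      exact ⟨r * s, by rw [map_mul, hs, ← Algebra.smul_def]; rfl⟩

lemma diag_mem_scalars (g y : Matrix (Fin 3) (Fin 3) ℍ[k,a,b,c]) (hy : y ∈ YC a b c) (i : Fin 3) :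
    (g * y * g.conjTranspose) i i ∈ Set.range (algebraMap k ℍ[k,a,b,c]) := by
  obtain ⟨h, hd⟩ := hy
  have hs : ∀ j l, star (y j l) = y l j := fun j l => congrFun (congrFun h l) j
  have hdiag : ∀ j, g i j * y j j * star (g i j) ∈ (algebraMap k ℍ[k,a,b,c]).range := by
    intro j
    obtain ⟨r, hr⟩ := hd j
    rw [← hr, ← Algebra.commutes, mul_assoc]
    refine Subring.mul_mem _ ⟨r, rfl⟩ ⟨(g i j * star (g i j)).re, ?_⟩
    exact (QuaternionAlgebra.mul_star_eq_coe _).symm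
  have hoff : ∀ j l, g i j * y j l * star (g i l) + g i l * y l j * star (g i j) ∈
      (algebraMap k ℍ[k,a,b,c]).range := by
    intro j l
    have : g i l * y l j * star (g i j) = star (g i j * y j l * star (g i l)) := by
      simp [hs, mul_assoc]
    rw [this]
    exact star_mem_scalars a b c
  have e : (g * y * g.conjTranspose) i i =
      (g i 0 * y 0 0 * star (g i 0) + g i 1 * y 1 1 * star (g i 1) + g i 2 * y 2 2 * star (g i 2))
      + (g i 0 * y 0 1 * star (g i 1) + g i 1 * y 1 0 * star (g i 0))
      + (g i 0 * y 0 2 * star (g i 2) + g i 2 * y 2 0 * star (g i 0))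
      + (g i 1 * y 1 2 * star (g i 2) + g i 2 * y 2 1 * star (g i 1)) := by
    simp only [Matrix.mul_apply, Fin.sum_univ_three, Matrix.conjTranspose_apply, add_mul]
    abel
  rw [e]
  exact Subring.add_mem _ (Subring.add_mem _ (Subring.add_mem _ (Subring.add_mem _
    (Subring.add_mem _ (hdiag 0) (hdiag 1)) (hdiag 2)) (hoff 0 1)) (hoff 0 2)) (hoff 1 2)

/-- `g · y = g y g^ι`, where `g^ι` is the conjugate transpose. -/
instance : DistribMulAction (GL3 ℍ[k,a,b,c]) (YC a b c) where
  smul g y := ⟨g.1 * y.1 * g.1.conjTranspose, by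
    refine ⟨?_, diag_mem_scalars a b c g.1 y.1 y.2⟩
    rw [Matrix.conjTranspose_mul, Matrix.conjTranspose_mul, Matrix.conjTranspose_conjTranspose,
      y.2.1, Matrix.mul_assoc]⟩
  one_smul y := by
    refine Subtype.ext ?_
    change (1 : Matrix (Fin 3) (Fin 3) ℍ[k,a,b,c]) * y.1 * Matrix.conjTranspose 1 = y.1
    simp
  mul_smul g h y := by
    refine Subtype.ext ?_
    change (g.1 * h.1) * y.1 * (g.1 * h.1).conjTranspose =
      g.1 * (h.1 * y.1 * h.1.conjTranspose) * g.1.conjTranspose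
    simp only [Matrix.conjTranspose_mul, Matrix.mul_assoc]
  smul_zero g := by
    refine Subtype.ext ?_
    change g.1 * 0 * g.1.conjTranspose = 0
    simp
  smul_add g y z := by
    refine Subtype.ext ?_
    change g.1 * (y.1 + z.1) * g.1.conjTranspose =
      g.1 * y.1 * g.1.conjTranspose + g.1 * z.1 * g.1.conjTranspose
    simp only [mul_add, add_mul]

instance : SMulCommClass (GL3 ℍ[k,a,b,c]) k (YC a b c) where
  smul_comm g r y := by
    refine Subtype.ext ?_
    change g.1 * (r • y.1) * g.1.conjTranspose = r • (g.1 * y.1 * g.1.conjTranspose)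
    simp

variable {a b c} in
/-- The linear form `q₁ v₁ + q₂ v₂` with quaternion coefficients, as an element of the quaternion
algebra over `k[v₁, v₂]` with the same parameters. -/
def linearQuaternion (q₁ q₂ : ℍ[k,a,b,c]) :
    ℍ[MvPolynomial (Fin 2) k,(C a),(C b),(C c)] where
  re := C q₁.re * X 0 + C q₂.re * X 1
  imI := C q₁.imI * X 0 + C q₂.imI * X 1
  imJ := C q₁.imJ * X 0 + C q₂.imJ * X 1
  imK := C q₁.imK * X 0 + C q₂.imK * X 1

variable {a b c} in
/-- All four coordinates are homogeneous of degree `n`. -/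
def QuaternionHomogeneous (n : ℕ) (q : ℍ[MvPolynomial (Fin 2) k,(C a),(C b),(C c)]) : Prop :=
  q.re.IsHomogeneous n ∧ q.imI.IsHomogeneous n ∧ q.imJ.IsHomogeneous n ∧ q.imK.IsHomogeneous n

variable {a b c} in
lemma quaternionHomogeneous_mul {m n : ℕ} {p q : ℍ[MvPolynomial (Fin 2) k,(C a),(C b),(C c)]}
    (hp : QuaternionHomogeneous m p) (hq : QuaternionHomogeneous n q) :
    QuaternionHomogeneous (m + n) (p * q) := by
  obtain ⟨p1, p2, p3, p4⟩ := hp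
  obtain ⟨q1, q2, q3, q4⟩ := hq
  have h : ∀ (r : k) {s t : MvPolynomial (Fin 2) k}, s.IsHomogeneous m → t.IsHomogeneous n →
      (C r * s * t).IsHomogeneous (m + n) := fun r s t hs ht => (hs.C_mul r).mul ht
  have h2 : ∀ (r r' : k) {s t : MvPolynomial (Fin 2) k}, s.IsHomogeneous m → t.IsHomogeneous n →
      (C r * C r' * s * t).IsHomogeneous (m + n) := fun r r' s t hs ht => by
    rw [← C_mul]
    exact h _ hs ht
  refine ⟨?_, ?_, ?_, ?_⟩
  · rw [QuaternionAlgebra.re_mul]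
    exact (((((p1.mul q1).add (h _ p2 q2)).add (h _ p3 q3)).add (h2 _ _ p3 q4)).sub
      (h2 _ _ p4 q4))
  · rw [QuaternionAlgebra.imI_mul]
    exact ((((p1.mul q2).add (p2.mul q1)).add (h _ p2 q2)).sub (h _ p3 q4)).add (h _ p4 q3)
  · rw [QuaternionAlgebra.imJ_mul]
    exact ((((p1.mul q3).add (h _ p2 q4)).add (p3.mul q1)).add (h _ p3 q2)).sub (h _ p4 q2)
  · rw [QuaternionAlgebra.imK_mul]
    exact ((((p1.mul q4).add (p2.mul q3)).add (h _ p2 q4)).sub (p3.mul q2)).add (p4.mul q1)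

variable {a b c} in
lemma quaternionHomogeneous_star {n : ℕ} {q : ℍ[MvPolynomial (Fin 2) k,(C a),(C b),(C c)]}
    (hq : QuaternionHomogeneous n q) : QuaternionHomogeneous n (star q) :=
  ⟨hq.1.add (hq.2.1.C_mul b), hq.2.1.neg, hq.2.2.1.neg, hq.2.2.2.neg⟩

variable {a b c} in
/-- The matrix `x(v) = x₁ v₁ + x₂ v₂` of linear forms. -/
def linearMatrixC (x₁ x₂ : Matrix (Fin 3) (Fin 3) ℍ[k,a,b,c]) :
    Matrix (Fin 3) (Fin 3) ℍ[MvPolynomial (Fin 2) k,(C a),(C b),(C c)] :=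
  Matrix.of fun i j => linearQuaternion (x₁ i j) (x₂ i j)

variable {a b c} in
lemma isHomogeneous_pfaff3 (x₁ x₂ : Matrix (Fin 3) (Fin 3) ℍ[k,a,b,c]) :
    (pfaff3 (linearMatrixC x₁ x₂)).IsHomogeneous 3 := by
  have h : ∀ i j, QuaternionHomogeneous 1 (linearMatrixC x₁ x₂ i j) := fun i j =>
    ⟨(isHomogeneous_C_mul_X _ _).add (isHomogeneous_C_mul_X _ _),
      (isHomogeneous_C_mul_X _ _).add (isHomogeneous_C_mul_X _ _),
      (isHomogeneous_C_mul_X _ _).add (isHomogeneous_C_mul_X _ _),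
      (isHomogeneous_C_mul_X _ _).add (isHomogeneous_C_mul_X _ _)⟩
  have hN : ∀ i j l, ((linearMatrixC x₁ x₂ l l).re *
      qNorm (linearMatrixC x₁ x₂ i j)).IsHomogeneous 3 := fun i j l =>
    (h l l).1.mul (quaternionHomogeneous_mul (h i j) (quaternionHomogeneous_star (h i j))).1
  have h3 := quaternionHomogeneous_mul (quaternionHomogeneous_mul (h 0 1) (h 1 2)) (h 2 0)
  have hT : (qTrace (linearMatrixC x₁ x₂ 0 1 * linearMatrixC x₁ x₂ 1 2 *
      linearMatrixC x₁ x₂ 2 0)).IsHomogeneous 3 := h3.1.add (quaternionHomogeneous_star h3).1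
  exact ((((((h 0 0).1.mul (h 1 1).1).mul (h 2 2).1).sub (hN _ _ _)).sub (hN _ _ _)).sub
    (hN _ _ _)).add hT

/-- `F_x(v) = Pfaff₃(x(v))`. -/
def formC (x : Pair (YC a b c)) : BinaryCubic k :=
  ⟨pfaff3 (linearMatrixC x.1.1 x.2.1), isHomogeneous_pfaff3 x.1.1 x.2.1⟩

instance : IsDedekindFiniteMonoid ℍ[k,a,b,c] :=
  have : IsArtinianRing ℍ[k,a,b,c] := IsArtinianRing.of_finite k _
  inferInstance

/-- `G(k)` in case (c). -/
abbrev GC : Type u := GL3 ℍ[k,a,b,c] × Matrix.GeneralLinearGroup (Fin 2) k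

/-- `P(k) = P_{1,2}(B) × B₂(k)`. -/
def PC : Subgroup (GC a b c) := (P12 ℍ[k,a,b,c]).prod (B2 k)

/-- The matrices in `H₃(B)` with vanishing first row and first column. -/
def ZC : Submodule k (YC a b c) where
  carrier := {y | ∀ i, y.1 0 i = 0 ∧ y.1 i 0 = 0}
  zero_mem' := by simp
  add_mem' := by
    intro y z hy hz i
    simp [hy i, hz i]
  smul_mem' := by
    intro r y hy i
    simp [hy i]

/-- `V⁽²⁾` in case (c). -/
def V2C : Set (Pair (YC a b c)) := typeOneTwoSet (formC a b c)

/-- `W = Z ⊕ Y` in case (c). -/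
def WC : Submodule k (Pair (YC a b c)) := firstIn (ZC a b c)

/-- `W⁽²⁾ = W ∩ V⁽²⁾` in case (c). -/
def W2C : Set (Pair (YC a b c)) := WC a b c ∩ V2C a b c

end CaseC

end CubicOrbits

end

/-!
The proof reduces all three cases to one statement about a covariant cubic form,
`contractedProduct_of_covariant`.

A binary cubic form `f` of nonzero discriminant for which `Γ(Z_f, 𝒪) ≅ k × F`, with `F / k` a
quadratic field extension, has exactly one rational zero in `ℙ¹(k)` (`exists_unique_zero`). To see
this, choose a quadratic form `s` without a zero in common with `f`, which is possible even over the
field with two elements (`exists_isTransversal`); then `Z_f` is affine, with ring of functions the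
degree zero part of the localization of `k[v₁, v₂] / (f)` at `s`
(`IsTransversal.exists_globalSections_equiv`). Rational zeros of `f` are the `k`-algebra
homomorphisms `k × F → k`, and there is only one of these, the first projection. Having type
`(1, 2)` is invariant under `GL₂(k)` and scaling (`IsTransform.isTypeOneTwo`).

Let `x` be in `V⁽²⁾`. An element of `GL₂(k)` moves the rational zero of `F_x` to `(1, 0)`. Then
`x₁` is a zero of the cubic form on `Y`, and a smooth point of the zero set, as the zero of `F_x` is
simple. Hence `x₁` is a matrix of "rank two", which some element of `G₁` moves into `Z`. So
every orbit in `V⁽²⁾` meets `W`. If `w` and `g w` are both in `W⁽²⁾`, then the `GL₂(k)`-component of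
`g` fixes the only rational zero `(1, 0)` of `F_w`, so that it is lower triangular, and the
`G₁`-component `g₁` moves `w₁ ∈ Z` into `Z`. The complementary `2 × 2` block of `w₁` is invertible,
again because the zero is simple, so the left kernel of `w₁` is spanned by the first basis vector
and `g₁` is in the parabolic subgroup. These facts together say that `G ×_P W⁽²⁾ → V⁽²⁾` is
bijective.

In cases (a) and (b) the facts on matrices are linear algebra over a field. In case (c) the
determinant is replaced by the Pfaffian and the adjugate by a quadratic adjoint with
`h h^# = Pfaff₃(h)`, which is also the gradient of the Pfaffian (`HermitianData.derivation_pf`).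
Two points need an argument there. That `Pfaff₃(g x g^ι)` is a constant multiple of
`Pfaff₃(x)` for pairs `x` with `P(x) ≠ 0` is derived from the behaviour of the adjoint, without the
reduced norm: it shows that the form `F` of `x` divides all products of the form `F'` of `g x` with
partial derivatives of `F`, and since `F` has no multiple factors it divides `F'`
(`exists_pfaff3_congruence`). That a singular Hermitian matrix `y` with `y^# ≠ 0` can be moved into
`Z` holds because the nonzero Hermitian form `y^#` has a nonzero value, so that, in a suitable
basis, the first row of `y^#` extends to an invertible matrix; this row annihilates `y`
(`HermitianData.exists_mul_row_eq_zero`).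
-/

open MvPolynomial

noncomputable section

namespace CubicOrbits

universe u v

/-! ### Global sections of the zero scheme of a binary cubic form -/

section Proj

attribute [local instance] MvPolynomial.gradedAlgebra

variable {k : Type u} [Field k]

/-- The structure map of the `k`-algebra `(A_s)₀`, where `A = k[v₁, v₂] / (f)`. -/
def scalarToAway (f : BinaryCubic k) (s : MvPolynomial (Fin 2) k ⧸ Ideal.span {f.1}) :
    k →+* HomogeneousLocalization.Away (grading f) s :=
  (HomogeneousLocalization.fromZeroRingHom (grading f) _).comp (algebraMap k (grading f 0))

/-- The form `h` has no zero in common with `f` over an algebraic closure, in the sense of the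
projective Nullstellensatz: `v₁` and `v₂` lie in the radical of `(f, h)`. -/
def IsTransversal (f : BinaryCubic k) (h : MvPolynomial (Fin 2) k) : Prop :=
  ∀ i, X i ∈ (Ideal.span {f.1, h}).radical

lemma IsTransversal.exists_pow_eq {f : BinaryCubic k} {h : MvPolynomial (Fin 2) k}
    (hfh : IsTransversal f h) (i : Fin 2) : ∃ (n : ℕ) (u w : MvPolynomial (Fin 2) k),
      X i ^ n = u * f.1 + w * h := by
  obtain ⟨n, hn⟩ := hfh i
  obtain ⟨u, w, e⟩ := Ideal.mem_span_pair.1 hn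
  exact ⟨n, u, w, e.symm⟩

lemma mk_mem_grading (f : BinaryCubic k) {n : ℕ} {p : MvPolynomial (Fin 2) k}
    (hp : p.IsHomogeneous n) : Ideal.Quotient.mk (Ideal.span {f.1}) p ∈ grading f n :=
  ⟨p, hp, rfl⟩

lemma mk_self_eq_zero (f : BinaryCubic k) : Ideal.Quotient.mk (Ideal.span {f.1}) f.1 = 0 :=
  Ideal.Quotient.eq_zero_iff_mem.2 (Ideal.mem_span_singleton_self _)

lemma adjoin_variables_eq_top (f : BinaryCubic k) :
    Algebra.adjoin (grading f 0)
      (Set.range fun i => Ideal.Quotient.mk (Ideal.span {f.1}) (X i)) = ⊤ := by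
  refine top_le_iff.1 fun x _ => ?_
  obtain ⟨p, rfl⟩ := Ideal.Quotient.mk_surjective x
  induction p using MvPolynomial.induction_on with
  | C r =>
    exact Subalgebra.algebraMap_mem _ (⟨_, mk_mem_grading f (isHomogeneous_C _ r)⟩ : grading f 0)
  | add p q hp hq =>
    rw [map_add]
    exact add_mem (hp trivial) (hq trivial)
  | mul_X p i hp =>
    rw [map_mul]
    exact mul_mem (hp trivial) (Algebra.subset_adjoin ⟨i, rfl⟩)

open AlgebraicGeometry in
/-- The nonvanishing locus of a transversal form is all of `Proj k[v₁, v₂] / (f)`. -/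
lemma IsTransversal.basicOpen_eq_top {f : BinaryCubic k} {h : MvPolynomial (Fin 2) k}
    (hfh : IsTransversal f h) :
    Proj.basicOpen (grading f) (Ideal.Quotient.mk (Ideal.span {f.1}) h) = ⊤ := by
  refine top_le_iff.1 ?_
  rw [← Proj.iSup_basicOpen_eq_top' (grading f)
    (fun i => Ideal.Quotient.mk (Ideal.span {f.1}) (X i))
    (fun i => ⟨1, mk_mem_grading f (isHomogeneous_X _ i)⟩) (adjoin_variables_eq_top f)]
  refine iSup_le fun i => ?_
  obtain ⟨n, u, w, e⟩ := hfh.exists_pow_eq i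
  rw [← Proj.basicOpen_pow (grading f) _ (n + 1) n.succ_pos]
  refine Proj.basicOpen_mono _ _ _ ⟨Ideal.Quotient.mk (Ideal.span {f.1}) (w * X i), ?_⟩
  rw [← map_pow, pow_succ, e, ← map_mul, add_mul, map_add, mul_right_comm, map_mul _ _ f.1,
    mk_self_eq_zero, mul_zero, zero_add]
  congr 1
  ring

open AlgebraicGeometry CategoryTheory in
/-- A scheme isomorphic to `Spec S` over `Spec R` has global sections `S`, compatibly with the
structure morphisms. -/
lemma exists_ringEquiv_of_isIso {R S : Type u} [CommRing R] [CommRing S] {Z : Scheme.{u}}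
    (s : Z ⟶ Spec (.of R)) (j : Spec (.of S) ⟶ Z) [IsIso j] (φ : R →+* S)
    (hφ : j ≫ s = Spec.map (CommRingCat.ofHom φ)) :
    ∃ e : Γ(Z, ⊤) ≃+* S, ∀ r, e (((Scheme.ΓSpecIso (.of R)).inv ≫ s.appTop).hom r) = φ r := by
  have : IsIso j.appTop := inferInstanceAs (IsIso (j.app ⊤))
  let e := asIso j.appTop ≪≫ Scheme.ΓSpecIso (.of S)
  refine ⟨e.commRingCatIsoToRingEquiv, fun r => ?_⟩
  have key : ((Scheme.ΓSpecIso (.of R)).inv ≫ s.appTop) ≫ e.hom = CommRingCat.ofHom φ := by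
    have h2 : s.appTop ≫ j.appTop = (j ≫ s).appTop := (Scheme.Hom.comp_appTop _ _).symm
    simp only [e, Iso.trans_hom, asIso_hom, Category.assoc]
    rw [reassoc_of% h2, hφ, Scheme.ΓSpecIso_naturality, Iso.inv_hom_id_assoc]
  exact congrArg (fun ψ => ψ.hom r) key

open AlgebraicGeometry CategoryTheory in
/-- If a form `h` of positive degree is transversal to `f`, then `Proj k[v₁, v₂] / (f)` is affine
with coordinate ring `(A_h)₀`, where `A = k[v₁, v₂] / (f)`. -/
lemma IsTransversal.exists_globalSections_equiv {f : BinaryCubic k} {h : MvPolynomial (Fin 2) k}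
    (hfh : IsTransversal f h) {m : ℕ} (hm : 0 < m) (hh : h.IsHomogeneous m) :
    ∃ e : globalSections f ≃+*
        HomogeneousLocalization.Away (grading f) (Ideal.Quotient.mk (Ideal.span {f.1}) h),
      ∀ r, e (algebraMap k _ r) = scalarToAway f _ r := by
  have : IsIso (Proj.awayι (grading f) _ (mk_mem_grading f hh) hm) :=
    isIso_of_isOpenImmersion_of_opensRange_eq_top _
      (by rw [Proj.opensRange_awayι, hfh.basicOpen_eq_top])
  refine exists_ringEquiv_of_isIso (Z := Proj (grading f))
    (Proj.toSpecZero (grading f) ≫ Spec.map (CommRingCat.ofHom (algebraMap k (grading f 0))))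
    (Proj.awayι (grading f) _ (mk_mem_grading f hh) hm) (scalarToAway f _) ?_
  rw [Proj.awayι_toSpecZero_assoc, ← Spec.map_comp]
  rfl

end Proj

/-! ### Coefficients of binary cubic forms -/

section Coefficients

variable {k : Type u} [Field k]

/-- The binary form `a v₁³ + b v₁² v₂ + c v₁ v₂² + d v₂³` attached to `a X³ + b X² + c X + d`. -/
def homogenized {R : Type*} [CommRing R] (t : Cubic R) : MvPolynomial (Fin 2) R :=
  C t.a * X 0 ^ 3 + C t.b * (X 0 ^ 2 * X 1) + C t.c * (X 0 * X 1 ^ 2) + C t.d * X 1 ^ 3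

/-- The coefficients of a binary cubic form. -/
def coeffs (f : BinaryCubic k) : Cubic k where
  a := coeff (Finsupp.single 0 3) f.1
  b := coeff (Finsupp.single 0 2 + Finsupp.single 1 1) f.1
  c := coeff (Finsupp.single 0 1 + Finsupp.single 1 2) f.1
  d := coeff (Finsupp.single 1 3) f.1

lemma disc_eq_discr (f : BinaryCubic k) : disc f = (coeffs f).discr := rfl

lemma homogenized_eq_monomials (t : Cubic k) : homogenized t =
    monomial (Finsupp.single 0 3) t.a + monomial (Finsupp.single 0 2 + Finsupp.single 1 1) t.b +
      monomial (Finsupp.single 0 1 + Finsupp.single 1 2) t.c +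
      monomial (Finsupp.single 1 3) t.d := by
  simp only [homogenized, X_pow_eq_monomial]
  simp only [X, C_mul_monomial, monomial_mul, mul_one]

lemma fin_two_finsupp_ext_iff {m n : Fin 2 →₀ ℕ} : m = n ↔ m 0 = n 0 ∧ m 1 = n 1 := by
  constructor
  · rintro rfl
    exact ⟨rfl, rfl⟩
  · rintro ⟨h0, h1⟩
    ext i
    fin_cases i
    · exact h0
    · exact h1

lemma coeff_homogenized (t : Cubic k) (m : Fin 2 →₀ ℕ) : coeff m (homogenized t) =
    (if 3 = m 0 ∧ 0 = m 1 then t.a else 0) + (if 2 = m 0 ∧ 1 = m 1 then t.b else 0) +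
      (if 1 = m 0 ∧ 2 = m 1 then t.c else 0) + (if 0 = m 0 ∧ 3 = m 1 then t.d else 0) := by
  simp only [homogenized_eq_monomials, coeff_add, coeff_monomial, fin_two_finsupp_ext_iff]
  simp

lemma isHomogeneous_homogenized (t : Cubic k) : (homogenized t).IsHomogeneous 3 := by
  rw [homogenized_eq_monomials]
  refine (((isHomogeneous_monomial _ ?_).add (isHomogeneous_monomial _ ?_)).add
    (isHomogeneous_monomial _ ?_)).add (isHomogeneous_monomial _ ?_) <;>
  simp [Finsupp.degree_eq_sum]

lemma homogenized_coeffs (f : BinaryCubic k) : homogenized (coeffs f) = f.1 := by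
  ext m
  by_cases hm : m.degree = 3
  · have h3 : m 0 + m 1 = 3 := by simpa [Finsupp.degree_eq_sum] using hm
    have hc : ∀ n : Fin 2 →₀ ℕ, n 0 = m 0 → n 1 = m 1 → coeff n f.1 = coeff m f.1 :=
      fun n h0 h1 => by rw [fin_two_finsupp_ext_iff.2 ⟨h0, h1⟩]
    have h01 : m 0 ≤ 3 := by omega
    rw [coeff_homogenized]
    generalize m 0 = i at *
    generalize m 1 = j at *
    obtain rfl : j = 3 - i := by omega
    interval_cases i <;> simp only [coeffs] <;> norm_num <;> exact hc _ (by simp) (by simp)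
  · rw [IsHomogeneous.coeff_eq_zero (isHomogeneous_homogenized _) hm,
      IsHomogeneous.coeff_eq_zero f.2 hm]

lemma coeffs_eq_of_eq_homogenized {f : BinaryCubic k} {t : Cubic k} (h : f.1 = homogenized t) :
    coeffs f = t := by
  ext <;> simp [coeffs, h, coeff_homogenized]

/-- The value of `t` at the point `(x, y)`. -/
def cubicVal {R : Type*} [CommRing R] (t : Cubic R) (x y : R) : R :=
  t.a * x ^ 3 + t.b * (x ^ 2 * y) + t.c * (x * y ^ 2) + t.d * y ^ 3

lemma eval_eq_cubicVal (f : BinaryCubic k) (p : Fin 2 → k) :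
    eval p f.1 = cubicVal (coeffs f) (p 0) (p 1) := by
  conv_lhs => rw [← homogenized_coeffs f]
  simp [homogenized, cubicVal]

end Coefficients

/-! ### Rational zeros and the type of the algebra of global sections -/

section Roots

attribute [local instance] MvPolynomial.gradedAlgebra

variable {k : Type u} [Field k]

/-- The binary quadratic form `α v₁² + β v₁ v₂ + γ v₂²`. -/
def binaryQuadratic (α β γ : k) : MvPolynomial (Fin 2) k :=
  C α * X 0 ^ 2 + C β * (X 0 * X 1) + C γ * X 1 ^ 2

lemma isHomogeneous_binaryQuadratic (α β γ : k) : (binaryQuadratic α β γ).IsHomogeneous 2 :=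
  ((((isHomogeneous_X _ 0).pow 2).C_mul α).add
    (((isHomogeneous_X _ 0).mul (isHomogeneous_X _ 1)).C_mul β)).add
    (((isHomogeneous_X _ 1).pow 2).C_mul γ)

lemma mem_radical_of_C_mul_pow_eq {f h u w : MvPolynomial (Fin 2) k} {i : Fin 2} {r : k}
    (hr : r ≠ 0) {n : ℕ} (e : C r * X i ^ n = u * f + w * h) :
    X i ∈ (Ideal.span {f, h}).radical := by
  refine ⟨n, Ideal.mem_span_pair.2 ⟨C r⁻¹ * u, C r⁻¹ * w, ?_⟩⟩
  rw [mul_assoc, mul_assoc, ← mul_add, ← e, ← mul_assoc, ← C_mul, inv_mul_cancel₀ hr, C_1, one_mul]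

/-- Over every field, however small, a binary cubic form of nonzero discriminant has a transversal
quadratic form. -/
lemma exists_isTransversal (f : BinaryCubic k) (hf : disc f ≠ 0) :
    ∃ α β γ : k, IsTransversal f (binaryQuadratic α β γ) := by
  have hf' := homogenized_coeffs f
  rw [disc_eq_discr] at hf
  generalize coeffs f = t at hf hf'
  unfold homogenized at hf'
  by_cases ha : t.a = 0
  · by_cases hd : t.d = 0
    · -- The zeros are `(1, 0)`, `(0, 1)` and `(c, -b)` with `b, c ≠ 0`.
      have hbc : t.b * t.c ≠ 0 := fun h => hf (by
        rw [Cubic.discr, ha, hd]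
        linear_combination t.b * t.c * h)
      obtain ⟨s, hs⟩ : ∃ s : k, t.b ^ 2 - t.b * t.c * s + t.c ^ 2 ≠ 0 := by
        by_cases h0 : t.b ^ 2 + t.c ^ 2 = 0
        · exact ⟨1, fun h => hbc (by linear_combination h0 - h)⟩
        · exact ⟨0, by simpa using h0⟩
      refine ⟨1, s, 1, Fin.forall_fin_two.2 ⟨?_, ?_⟩⟩
      · refine mem_radical_of_C_mul_pow_eq hs (n := 4)
          (u := -(C s * C (t.b - t.c * s) * X 0 + C (t.b - t.c * s) * X 1 + C t.c * X 0))
          (w := C (t.b - t.c * s) ^ 2 * X 0 ^ 2 + C t.c * X 0 *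
            (C s * C (t.b - t.c * s) * X 0 + C (t.b - t.c * s) * X 1 + C t.c * X 0)) ?_
        rw [← hf', binaryQuadratic, ha, hd]
        simp only [C_1, C_0, C_mul, C_add, C_sub, C_pow]
        ring
      · refine mem_radical_of_C_mul_pow_eq hs (n := 4)
          (u := -(C s * C (t.c - t.b * s) * X 1 + C (t.c - t.b * s) * X 0 + C t.b * X 1))
          (w := C (t.c - t.b * s) ^ 2 * X 1 ^ 2 + C t.b * X 1 *
            (C s * C (t.c - t.b * s) * X 1 + C (t.c - t.b * s) * X 0 + C t.b * X 1)) ?_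
        rw [← hf', binaryQuadratic, ha, hd]
        simp only [C_1, C_0, C_mul, C_add, C_sub, C_pow]
        ring
    · refine ⟨1, 0, 0, Fin.forall_fin_two.2 ⟨?_, ?_⟩⟩
      · refine mem_radical_of_C_mul_pow_eq one_ne_zero (n := 2) (u := 0) (w := 1) ?_
        simp [binaryQuadratic]
      · refine mem_radical_of_C_mul_pow_eq (pow_ne_zero 2 hd) (n := 4)
          (u := C t.d * X 1 - C t.c * X 0)
          (w := C t.c ^ 2 * X 1 ^ 2 -
            (C t.d * X 1 - C t.c * X 0) * (C t.b * X 1 + C t.a * X 0)) ?_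
        rw [← hf', binaryQuadratic]
        simp only [C_1, C_0, C_pow]
        ring
  · refine ⟨0, 0, 1, Fin.forall_fin_two.2 ⟨?_, ?_⟩⟩
    · refine mem_radical_of_C_mul_pow_eq (pow_ne_zero 2 ha) (n := 4)
        (u := C t.a * X 0 - C t.b * X 1)
        (w := C t.b ^ 2 * X 0 ^ 2 -
          (C t.a * X 0 - C t.b * X 1) * (C t.c * X 0 + C t.d * X 1)) ?_
      rw [← hf', binaryQuadratic]
      simp only [C_1, C_0, C_pow]
      ring
    · refine mem_radical_of_C_mul_pow_eq one_ne_zero (n := 2) (u := 0) (w := 1) ?_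
      simp [binaryQuadratic]

/-- The algebra `k × F` has only one `k`-point when `F` is a quadratic field. -/
lemma algHom_prod_eq_fst {F : Type*} [Field F] [Algebra k F] (hF : Module.finrank k F = 2)
    (φ : k × F →ₐ[k] k) : φ = AlgHom.fst k k F := by
  have hsplit : ∀ x : F, φ (0, x) = 0 := by
    have hidem : φ (0, 1) * φ (0, 1) = φ (0, 1) := by
      rw [← map_mul]
      simp
    rcases mul_eq_zero.1 (show φ (0, 1) * (φ (0, 1) - 1) = 0 by
      rw [mul_sub, hidem, mul_one, sub_self]) with h0 | h1
    · intro x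
      calc φ (0, x) = φ (0, x) * φ (0, 1) := by rw [← map_mul]; simp
        _ = 0 := by rw [h0, mul_zero]
    · -- Otherwise `x ↦ φ (0, x)` embeds `F` in `k`.
      exfalso
      replace h1 := sub_eq_zero.1 h1
      let ψ : F →+* k :=
        { toFun := fun x => φ (0, x)
          map_one' := h1
          map_mul' := fun x y => by rw [← map_mul]; simp
          map_zero' := map_zero φ
          map_add' := fun x y => by rw [← map_add]; simp }
      have hψ : ∀ r : k, ψ (algebraMap k F r) = r := fun r => by
        have e : ((0 : k), algebraMap k F r) = r • ((0 : k), (1 : F)) := by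
          ext <;> simp [Algebra.smul_def]
        change φ (0, algebraMap k F r) = r
        rw [e, map_smul, h1, smul_eq_mul, mul_one]
      have hsurj : Function.Surjective (algebraMap k F) := fun x =>
        ⟨ψ x, ψ.injective (hψ _)⟩
      have := Subalgebra.bot_eq_top_iff_finrank_eq_one (F := k) (E := F)
      rw [hF] at this
      exact absurd (this.1 (by
        refine eq_top_iff.2 fun x _ => ?_
        obtain ⟨r, rfl⟩ := hsurj x
        exact Subalgebra.algebraMap_mem _ r)) (by norm_num)
  ext x
  have e : x = algebraMap k (k × F) x.1 + (0, x.2 - algebraMap k F x.1) := by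
    ext <;> simp
  conv_lhs => rw [e]
  rw [map_add, hsplit, add_zero, AlgHom.commutes]
  rfl

variable {f : BinaryCubic k} {h : MvPolynomial (Fin 2) k}

/-- The fraction `q / h` of quadratic forms, as an element of `(A_h)₀`. -/
def quadraticFraction (hh : h.IsHomogeneous 2) (q : MvPolynomial (Fin 2) k)
    (hq : q.IsHomogeneous 2) :
    HomogeneousLocalization.Away (grading f) (Ideal.Quotient.mk (Ideal.span {f.1}) h) :=
  HomogeneousLocalization.Away.mk (grading f) (mk_mem_grading f hh) 1 (Ideal.Quotient.mk _ q)
    (mk_mem_grading f hq)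

/-- A rational zero of `f` gives a `k`-point of `(A_h)₀`, namely evaluation there. -/
lemma exists_evaluation {p : Fin 2 → k} (hp : eval p f.1 = 0) (hhp : eval p h ≠ 0) :
    ∃ φ : HomogeneousLocalization.Away (grading f) (Ideal.Quotient.mk (Ideal.span {f.1}) h) →+* k,
      (∀ r, φ (scalarToAway f _ r) = r) ∧
      ∀ (hh : h.IsHomogeneous 2) (q) (hq : q.IsHomogeneous 2),
        φ (quadraticFraction hh q hq) * eval p h = eval p q := by
  let ev : (MvPolynomial (Fin 2) k ⧸ Ideal.span {f.1}) →+* k :=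
    Ideal.Quotient.lift _ (eval p) fun x hx => by
      obtain ⟨y, rfl⟩ := Ideal.mem_span_singleton.1 hx
      rw [map_mul, hp, zero_mul]
  have hev : ∀ q, ev (Ideal.Quotient.mk _ q) = eval p q := fun q => Ideal.Quotient.lift_mk _ _ _
  have hu : IsUnit (ev (Ideal.Quotient.mk _ h)) := by
    rw [hev]
    exact hhp.isUnit
  let loc : Localization.Away (Ideal.Quotient.mk (Ideal.span {f.1}) h) →+* k :=
    IsLocalization.Away.lift _ hu
  have hl : ∀ x, loc (algebraMap _ _ x) = ev x := IsLocalization.Away.lift_eq _ hu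
  have hloc : ∀ x s, loc (Localization.mk x s) * ev s = ev x := fun x s => by
    rw [← hl, ← hl, ← map_mul, Localization.mk_eq_mk', IsLocalization.mk'_spec]
  refine ⟨loc.comp (algebraMap (HomogeneousLocalization.Away (grading f) _) _), fun r => ?_,
    fun hh q hq => ?_⟩
  · have := hloc (Ideal.Quotient.mk _ (C r)) 1
    rw [OneMemClass.coe_one, map_one, mul_one, hev, eval_C] at this
    exact this
  · have := hloc (Ideal.Quotient.mk _ q) ⟨Ideal.Quotient.mk _ h ^ 1, 1, rfl⟩
    have e : ev (Ideal.Quotient.mk _ h ^ 1) = eval p h := by rw [pow_one, hev]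
    rw [hev] at this
    rw [← this, e]
    rfl

/-- Computations with quadratic fractions take place in the localization `A_h`. -/
lemma exists_val_eq (f : BinaryCubic k) (hh : h.IsHomogeneous 2) :
    ∃ (j : MvPolynomial (Fin 2) k →+*
        Localization.Away (Ideal.Quotient.mk (Ideal.span {f.1}) h))
      (η : Localization.Away (Ideal.Quotient.mk (Ideal.span {f.1}) h)),
      j f.1 = 0 ∧ j h * η = 1 ∧
      (∀ q hq, (quadraticFraction (f := f) hh q hq).val = j q * η) ∧
      ∀ r, (scalarToAway f (Ideal.Quotient.mk (Ideal.span {f.1}) h) r).val = j (C r) := by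
  let s : Submonoid.powers (Ideal.Quotient.mk (Ideal.span {f.1}) h) :=
    ⟨Ideal.Quotient.mk _ h ^ 1, 1, rfl⟩
  have hs : (s : MvPolynomial (Fin 2) k ⧸ Ideal.span {f.1}) = Ideal.Quotient.mk _ h := pow_one _
  refine ⟨(algebraMap _ _).comp (Ideal.Quotient.mk (Ideal.span {f.1})), Localization.mk 1 s,
    ?_, ?_, ?_, ?_⟩
  · rw [RingHom.comp_apply, mk_self_eq_zero, map_zero]
  · rw [RingHom.comp_apply, ← Localization.mk_one_eq_algebraMap, Localization.mk_mul, mul_one,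
      one_mul]
    exact (congrArg (fun x => Localization.mk x s) hs.symm).trans (Localization.mk_self s)
  · intro q hq
    rw [RingHom.comp_apply, ← Localization.mk_one_eq_algebraMap, Localization.mk_mul, mul_one,
      one_mul]
    rfl
  · intro r
    rw [RingHom.comp_apply, ← Localization.mk_one_eq_algebraMap]
    rfl

lemma map_binaryQuadratic {S : Type*} [CommRing S] (j : MvPolynomial (Fin 2) k →+* S) (α β γ : k) :
    j (binaryQuadratic α β γ) =
      j (C α) * j (X 0) ^ 2 + j (C β) * (j (X 0) * j (X 1)) + j (C γ) * j (X 1) ^ 2 := by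
  simp only [binaryQuadratic, map_add, map_mul, map_pow]

/-- A `k`-point of `(A_h)₀` comes from a rational zero of `f`. -/
lemma exists_zero_of_point {α β γ : k}
    (χ : HomogeneousLocalization.Away (grading f)
      (Ideal.Quotient.mk (Ideal.span {f.1}) (binaryQuadratic α β γ)) →+* k)
    (hχ : ∀ r, χ (scalarToAway f _ r) = r) :
    ∃ p : Fin 2 → k, p ≠ 0 ∧ eval p f.1 = 0 := by
  have hh := isHomogeneous_binaryQuadratic α β γ
  obtain ⟨j, η, hf, hη, hval, hscal⟩ := exists_val_eq f hh
  have hx : (X 0 ^ 2 : MvPolynomial (Fin 2) k).IsHomogeneous 2 := (isHomogeneous_X k 0).pow 2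
  have hy : (X 1 ^ 2 : MvPolynomial (Fin 2) k).IsHomogeneous 2 := (isHomogeneous_X k 1).pow 2
  have hxy : (X 0 * X 1 : MvPolynomial (Fin 2) k).IsHomogeneous 2 :=
    (isHomogeneous_X k 0).mul (isHomogeneous_X k 1)
  replace hf : j (homogenized (coeffs f)) = 0 := by rw [homogenized_coeffs, hf]
  simp only [homogenized, map_add, map_mul, map_pow] at hf
  let s := quadraticFraction (f := f) hh _ hx
  let t := quadraticFraction (f := f) hh _ hy
  let m := quadraticFraction (f := f) hh _ hxy
  let c : k → _ := scalarToAway f (Ideal.Quotient.mk (Ideal.span {f.1}) (binaryQuadratic α β γ))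
  have hvals : s.val = j (X 0) ^ 2 * η ∧ t.val = j (X 1) ^ 2 * η ∧
      m.val = j (X 0) * j (X 1) * η := by
    simp only [s, t, m, hval, map_mul, map_pow, and_self]
  have hc : ∀ r, (c r).val = j (C r) := hscal
  obtain ⟨hs, ht, hm⟩ := hvals
  have e1 : c α * s + c β * m + c γ * t = 1 := by
    apply HomogeneousLocalization.val_injective
    simp only [HomogeneousLocalization.val_add, HomogeneousLocalization.val_mul, hs, ht, hm, hc,
      HomogeneousLocalization.val_one]
    linear_combination hη - η * map_binaryQuadratic j α β γ
  have e2 : m * m = s * t := by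
    apply HomogeneousLocalization.val_injective
    simp only [HomogeneousLocalization.val_mul, hs, ht, hm]
    ring
  have e3 : c (coeffs f).a * s ^ 3 + c (coeffs f).b * (s ^ 2 * m) + c (coeffs f).c * (s * m ^ 2) +
      c (coeffs f).d * m ^ 3 = 0 := by
    apply HomogeneousLocalization.val_injective
    simp only [HomogeneousLocalization.val_add, HomogeneousLocalization.val_mul,
      HomogeneousLocalization.val_pow, hs, hm, hc, HomogeneousLocalization.val_zero]
    linear_combination (j (X 0) * η) ^ 3 * hf
  have e4 : c (coeffs f).a * m ^ 3 + c (coeffs f).b * (m ^ 2 * t) + c (coeffs f).c * (m * t ^ 2) +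
      c (coeffs f).d * t ^ 3 = 0 := by
    apply HomogeneousLocalization.val_injective
    simp only [HomogeneousLocalization.val_add, HomogeneousLocalization.val_mul,
      HomogeneousLocalization.val_pow, ht, hm, hc, HomogeneousLocalization.val_zero]
    linear_combination (j (X 1) * η) ^ 3 * hf
  replace e1 := congrArg χ e1
  replace e2 := congrArg χ e2
  replace e3 := congrArg χ e3
  replace e4 := congrArg χ e4
  have hχ' : ∀ r, χ (c r) = r := hχ
  simp only [map_add, map_mul, map_pow, map_one, map_zero, hχ'] at e1 e2 e3 e4
  by_cases hs0 : χ s = 0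
  · by_cases ht0 : χ t = 0
    · have hm0 : χ m = 0 := by
        rw [hs0, zero_mul] at e2
        exact mul_self_eq_zero.1 e2
      rw [hs0, ht0, hm0] at e1
      simp at e1
    · refine ⟨![χ m, χ t], fun h => ht0 (congrFun h 1), ?_⟩
      rw [eval_eq_cubicVal]
      exact e4
  · refine ⟨![χ s, χ m], fun h => hs0 (congrFun h 0), ?_⟩
    rw [eval_eq_cubicVal]
    exact e3

/-- If the algebra of global sections is `k × F` with `F` a field, then the form has exactly one
zero in `ℙ¹(k)`. -/
theorem exists_unique_zero (hf : disc f ≠ 0) (hL : IsTypeOneTwo k (globalSections f)) :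
    (∃ p : Fin 2 → k, p ≠ 0 ∧ eval p f.1 = 0) ∧
    ∀ p q : Fin 2 → k, p ≠ 0 → q ≠ 0 → eval p f.1 = 0 → eval q f.1 = 0 →
      p 0 * q 1 = p 1 * q 0 := by
  obtain ⟨α, β, γ, hfh⟩ := exists_isTransversal f hf
  have hh := isHomogeneous_binaryQuadratic α β γ
  obtain ⟨e, he⟩ := hfh.exists_globalSections_equiv two_pos hh
  obtain ⟨F, _, _, hF, -, ⟨i⟩⟩ := hL
  refine ⟨?_, fun p q hp hq hfp hfq => ?_⟩
  · refine exists_zero_of_point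
      (((AlgHom.fst k k F).comp i.toAlgHom).toRingHom.comp e.symm.toRingHom) fun r => ?_
    have : e.symm (scalarToAway f _ r) = algebraMap k _ r := by rw [← he, e.symm_apply_apply]
    exact (congrArg ((AlgHom.fst k k F).comp i.toAlgHom) this).trans (AlgHom.commutes _ r)
  · have hne : ∀ p : Fin 2 → k, p ≠ 0 → eval p f.1 = 0 → eval p (binaryQuadratic α β γ) ≠ 0 := by
      intro p hp hfp h0
      refine hp (funext fun l => ?_)
      obtain ⟨n, u, w, hn⟩ := hfh.exists_pow_eq l
      have := congrArg (eval p) hn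
      rw [map_add, map_mul, map_mul, hfp, h0, mul_zero, mul_zero, add_zero, map_pow,
        eval_X] at this
      exact eq_zero_of_pow_eq_zero this
    obtain ⟨φ, hφ, hφ'⟩ := exists_evaluation (h := binaryQuadratic α β γ) hfp (hne p hp hfp)
    obtain ⟨ψ, hψ, hψ'⟩ := exists_evaluation (h := binaryQuadratic α β γ) hfq (hne q hq hfq)
    let pt : (HomogeneousLocalization.Away (grading f)
        (Ideal.Quotient.mk (Ideal.span {f.1}) (binaryQuadratic α β γ)) →+* k) → (_ →+* k) :=
      fun χ => (χ.comp e.toRingHom).comp i.symm.toRingEquiv.toRingHom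
    have hpt : ∀ χ, (∀ r, χ (scalarToAway f _ r) = r) → ∀ x, pt χ x = x.1 := fun χ hχ x =>
      congrArg (fun ρ : k × F →ₐ[k] k => ρ x) (algHom_prod_eq_fst hF
        { pt χ with
          commutes' := fun r => by
            change χ (e (i.symm (algebraMap k _ r))) = r
            rw [AlgEquiv.commutes, he, hχ] })
    have hφψ : ∀ x, φ x = ψ x := fun x => by
      have h1 := hpt φ hφ (i (e.symm x))
      rw [← hpt ψ hψ] at h1
      change φ (e (i.symm (i (e.symm x)))) = ψ (e (i.symm (i (e.symm x)))) at h1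
      simpa using h1
    have hx : (X 0 ^ 2 : MvPolynomial (Fin 2) k).IsHomogeneous 2 := (isHomogeneous_X k 0).pow 2
    have hy : (X 1 ^ 2 : MvPolynomial (Fin 2) k).IsHomogeneous 2 := (isHomogeneous_X k 1).pow 2
    have hxy : (X 0 * X 1 : MvPolynomial (Fin 2) k).IsHomogeneous 2 :=
      (isHomogeneous_X k 0).mul (isHomogeneous_X k 1)
    have key : ∀ s (hs : s.IsHomogeneous 2), eval p s * eval q (binaryQuadratic α β γ) =
        eval q s * eval p (binaryQuadratic α β γ) := fun s hs => by
      rw [← hφ' hh s hs, ← hψ' hh s hs, hφψ]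
      ring
    have k1 := key _ hx
    have k2 := key _ hy
    have k3 := key _ hxy
    simp only [map_mul, map_pow, eval_X] at k1 k2 k3
    have hz : (p 0 * q 1 - p 1 * q 0) ^ 2 * eval q (binaryQuadratic α β γ) = 0 := by
      linear_combination q 1 ^ 2 * k1 - 2 * q 0 * q 1 * k3 + q 0 ^ 2 * k2
    exact sub_eq_zero.1 (pow_eq_zero_iff two_ne_zero |>.1
      ((mul_eq_zero.1 hz).resolve_right (hne q hq hfq)))

end Roots

/-! ### Linear changes of variables -/

section Substitution

attribute [local instance] MvPolynomial.gradedAlgebra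

variable {k : Type u} [Field k]

/-- The substitution `v ↦ v g`. -/
def linearSubst (g : Matrix (Fin 2) (Fin 2) k) :
    MvPolynomial (Fin 2) k →ₐ[k] MvPolynomial (Fin 2) k :=
  aeval fun i => C (g 0 i) * X 0 + C (g 1 i) * X 1

lemma linearSubst_X (g : Matrix (Fin 2) (Fin 2) k) (i : Fin 2) :
    linearSubst g (X i) = C (g 0 i) * X 0 + C (g 1 i) * X 1 :=
  aeval_X _ _

lemma linearSubst_C (g : Matrix (Fin 2) (Fin 2) k) (r : k) : linearSubst g (C r) = C r :=
  aeval_C _ _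

lemma linearSubst_comp (g h : Matrix (Fin 2) (Fin 2) k) :
    (linearSubst g).comp (linearSubst h) = linearSubst (g * h) := by
  refine MvPolynomial.algHom_ext fun i => ?_
  simp only [AlgHom.comp_apply, linearSubst_X, map_add, map_mul, linearSubst_C, Matrix.mul_apply,
    Fin.sum_univ_two]
  ring

lemma linearSubst_one : linearSubst (1 : Matrix (Fin 2) (Fin 2) k) = AlgHom.id k _ := by
  refine MvPolynomial.algHom_ext fun i => ?_
  rw [linearSubst_X]
  revert i
  simp [Fin.forall_fin_two]

lemma linearSubst_isHomogeneous (g : Matrix (Fin 2) (Fin 2) k) {n : ℕ} {p : MvPolynomial (Fin 2) k}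
    (hp : p.IsHomogeneous n) : (linearSubst g p).IsHomogeneous n := by
  have := hp.aeval (τ := Fin 2) (fun i => C (g 0 i) * X 0 + C (g 1 i) * X 1)
    (n := 1) fun i => (isHomogeneous_C_mul_X _ _).add (isHomogeneous_C_mul_X _ _)
  rwa [one_mul] at this

lemma eval_linearSubst (g : Matrix (Fin 2) (Fin 2) k) (p : Fin 2 → k)
    (q : MvPolynomial (Fin 2) k) :
    eval p (linearSubst g q) = eval (Matrix.vecMul p g) q := by
  have : (aeval p).comp (linearSubst g) = (aeval (Matrix.vecMul p g) : _ →ₐ[k] k) := by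
    refine MvPolynomial.algHom_ext fun i => ?_
    rw [AlgHom.comp_apply, linearSubst_X]
    simp [Matrix.vecMul, dotProduct, mul_comm]
  exact congrArg (fun φ => φ q) this

/-- The coefficients of a cubic form after the substitution `v ↦ v g`. -/
def substCubic (g : Matrix (Fin 2) (Fin 2) k) (t : Cubic k) : Cubic k where
  a := cubicVal t (g 0 0) (g 0 1)
  b := 3 * t.a * g 0 0 ^ 2 * g 1 0 + t.b * (g 0 0 ^ 2 * g 1 1 + 2 * g 0 0 * g 1 0 * g 0 1) +
    t.c * (g 1 0 * g 0 1 ^ 2 + 2 * g 0 0 * g 0 1 * g 1 1) + 3 * t.d * g 0 1 ^ 2 * g 1 1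
  c := 3 * t.a * g 0 0 * g 1 0 ^ 2 + t.b * (g 1 0 ^ 2 * g 0 1 + 2 * g 1 0 * g 0 0 * g 1 1) +
    t.c * (g 0 0 * g 1 1 ^ 2 + 2 * g 1 0 * g 1 1 * g 0 1) + 3 * t.d * g 0 1 * g 1 1 ^ 2
  d := cubicVal t (g 1 0) (g 1 1)

lemma linearSubst_homogenized (g : Matrix (Fin 2) (Fin 2) k) (t : Cubic k) :
    linearSubst g (homogenized t) = homogenized (substCubic g t) := by
  simp only [homogenized, map_add, map_mul, map_pow, linearSubst_X, linearSubst_C, substCubic,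
    cubicVal, map_ofNat]
  ring

lemma homogenized_injective : Function.Injective (homogenized : Cubic k → _) := fun s _ h =>
  (coeffs_eq_of_eq_homogenized (f := ⟨_, isHomogeneous_homogenized s⟩) rfl).symm.trans
    (coeffs_eq_of_eq_homogenized (f := ⟨_, isHomogeneous_homogenized s⟩) h)

lemma substCubic_mul (g h : Matrix (Fin 2) (Fin 2) k) (t : Cubic k) :
    substCubic (g * h) t = substCubic g (substCubic h t) :=
  homogenized_injective <| by
    rw [← linearSubst_homogenized, ← linearSubst_homogenized, ← linearSubst_homogenized,
      ← linearSubst_comp, AlgHom.comp_apply]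

lemma discr_substCubic {g : Matrix (Fin 2) (Fin 2) k} (hg : g.det ≠ 0) :
    ∀ t, (substCubic g t).discr = g.det ^ 6 * t.discr := by
  -- Both sides are multiplicative in `g`, so diagonal matrices and transvections suffice.
  refine Matrix.diagonal_transvection_induction_of_det_ne_zero
    (fun g => ∀ t : Cubic k, (substCubic g t).discr = g.det ^ 6 * t.discr) g hg ?_ ?_ ?_
  · intro D _ t
    simp only [Matrix.det_fin_two, Cubic.discr, substCubic, cubicVal, Matrix.diagonal_apply_eq,
      Matrix.diagonal_apply_ne _ zero_ne_one, Matrix.diagonal_apply_ne _ one_ne_zero]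
    ring
  · rintro ⟨i, j, hij, c⟩ t
    rw [Matrix.TransvectionStruct.toMatrix_mk, Matrix.det_transvection_of_ne i j hij]
    simp only [Cubic.discr, substCubic, cubicVal]
    fin_cases i <;> fin_cases j <;> simp [Matrix.transvection] at hij ⊢ <;> ring
  · intro A B hA hB ihA ihB t
    rw [substCubic_mul, ihA, ihB, Matrix.det_mul]
    ring

/-- `f'` arises from `f` by an invertible change of variables and a nonzero scalar factor. -/
def IsTransform (f f' : BinaryCubic k) (g : Matrix.GeneralLinearGroup (Fin 2) k) : Prop :=
  ∃ c : k, c ≠ 0 ∧ f'.1 = C c * linearSubst g.1 f.1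

lemma IsTransform.disc_ne_zero {f f' : BinaryCubic k} {g : Matrix.GeneralLinearGroup (Fin 2) k}
    (h : IsTransform f f' g) (hf : disc f ≠ 0) : disc f' ≠ 0 := by
  obtain ⟨c, hc, e⟩ := h
  have hg : g.1.det ≠ 0 := (Matrix.isUnit_iff_isUnit_det _).1 g.isUnit |>.ne_zero
  let t := substCubic g.1 (coeffs f)
  have : coeffs f' = ⟨c * t.a, c * t.b, c * t.c, c * t.d⟩ := by
    refine coeffs_eq_of_eq_homogenized ?_
    rw [e, ← homogenized_coeffs f, linearSubst_homogenized]
    simp only [homogenized, C_mul, t]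
    ring
  have hd : disc f' = c ^ 4 * (g.1.det ^ 6 * disc f) := by
    rw [disc_eq_discr f, ← discr_substCubic hg, disc_eq_discr, this]
    simp only [Cubic.discr, t]
    ring
  rw [hd]
  exact mul_ne_zero (pow_ne_zero _ hc) (mul_ne_zero (pow_ne_zero _ hg) hf)

/-- A substitution maps `k[v₁, v₂] / (f)` to `k[v₁, v₂] / (f')` if it maps `f` into `(f')`. -/
def quotientSubst {f f' : BinaryCubic k} (g : Matrix (Fin 2) (Fin 2) k)
    (hg : linearSubst g f.1 ∈ Ideal.span {f'.1}) : GradedRingHom (grading f) (grading f') where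
  toRingHom := Ideal.quotientMap (Ideal.span {f'.1}) (linearSubst g).toRingHom (by
    rw [Ideal.span_le, Set.singleton_subset_iff]
    exact hg)
  map_mem := by
    rintro n _ ⟨p, hp, rfl⟩
    exact mk_mem_grading f' (linearSubst_isHomogeneous g hp)

lemma quotientSubst_comp {f f' : BinaryCubic k} {g g' : Matrix (Fin 2) (Fin 2) k}
    (hg : linearSubst g f.1 ∈ Ideal.span {f'.1}) (hg' : linearSubst g' f'.1 ∈ Ideal.span {f.1})
    (h : g' * g = 1) : (quotientSubst g' hg').comp (quotientSubst g hg) = .id (grading f) := by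
  ext x
  obtain ⟨p, rfl⟩ := Ideal.Quotient.mk_surjective x
  change Ideal.Quotient.mk _ (((linearSubst g').comp (linearSubst g)) p) = Ideal.Quotient.mk _ p
  rw [linearSubst_comp, h, linearSubst_one]
  rfl

open HomogeneousLocalization in
/-- An isomorphism of graded rings induces isomorphisms of homogeneous localizations. -/
lemma exists_homogeneousLocalization_equiv {A B : Type*} [CommRing A] [CommRing B]
    [Algebra k A] [Algebra k B] {𝒜 : ℕ → Submodule k A} {ℬ : ℕ → Submodule k B}
    [GradedAlgebra 𝒜] [GradedAlgebra ℬ] (φ : GradedRingHom 𝒜 ℬ) (ψ : GradedRingHom ℬ 𝒜)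
    (h1 : ψ.comp φ = .id 𝒜) (h2 : φ.comp ψ = .id ℬ) (s : A) :
    ∃ e : Away 𝒜 s ≃+* Away ℬ (φ s), ∀ (a : 𝒜 0) (b : ℬ 0), φ a = b →
      e (fromZeroRingHom 𝒜 _ a) = fromZeroRingHom ℬ _ b := by
  have hle : Submonoid.powers s ≤ (Submonoid.powers (φ s)).comap φ := by
    rw [Submonoid.powers_le]
    exact ⟨1, pow_one _⟩
  have h1' : ∀ a, ψ (φ a) = a := fun a => congrArg (fun ρ : GradedRingHom 𝒜 𝒜 => ρ a) h1
  have h2' : ∀ b, φ (ψ b) = b := fun b => congrArg (fun ρ : GradedRingHom ℬ ℬ => ρ b) h2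
  have hle' : Submonoid.powers (φ s) ≤ (Submonoid.powers s).comap ψ := by
    rw [Submonoid.powers_le]
    exact ⟨1, (pow_one _).trans (h1' s).symm⟩
  refine ⟨RingEquiv.ofRingHom (map φ hle) (map ψ hle') ?_ ?_, fun a b hab => ?_⟩
  · ext x
    obtain ⟨c, rfl⟩ := HomogeneousLocalization.mk_surjective x
    simp [map_mk, h2']
  · ext x
    obtain ⟨c, rfl⟩ := HomogeneousLocalization.mk_surjective x
    simp [map_mk, h1']
  · rw [RingEquiv.ofRingHom_apply]
    exact (map_mk _ _ _).trans (congrArg HomogeneousLocalization.mk (NumDenSameDeg.ext _ rfl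
      hab (map_one φ)))

open HomogeneousLocalization in
lemma exists_away_equiv {f f' : BinaryCubic k} {g g' : Matrix (Fin 2) (Fin 2) k}
    (hg : linearSubst g f.1 ∈ Ideal.span {f'.1}) (hg' : linearSubst g' f'.1 ∈ Ideal.span {f.1})
    (h1 : g' * g = 1) (h2 : g * g' = 1) (h : MvPolynomial (Fin 2) k) :
    ∃ e : Away (grading f) (Ideal.Quotient.mk (Ideal.span {f.1}) h) ≃+*
        Away (grading f') (Ideal.Quotient.mk (Ideal.span {f'.1}) (linearSubst g h)),
      ∀ r, e (scalarToAway f _ r) = scalarToAway f' _ r := by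
  obtain ⟨e, he⟩ := exists_homogeneousLocalization_equiv (quotientSubst g hg)
    (quotientSubst g' hg') (quotientSubst_comp hg hg' h1) (quotientSubst_comp hg' hg h2)
    (Ideal.Quotient.mk _ h)
  exact ⟨e, fun r => he _ _ (congrArg (Ideal.Quotient.mk _) (linearSubst_C g r))⟩

lemma IsTransversal.linearSubst {f f' : BinaryCubic k} {g g' : Matrix (Fin 2) (Fin 2) k}
    (hg : linearSubst g f.1 ∈ Ideal.span {f'.1}) (h2 : g * g' = 1) {h : MvPolynomial (Fin 2) k}
    (hfh : IsTransversal f h) : IsTransversal f' (linearSubst g h) := by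
  have hX : ∀ i, CubicOrbits.linearSubst g (X i) ∈
      (Ideal.span {f'.1, CubicOrbits.linearSubst g h}).radical := by
    intro i
    obtain ⟨n, u, w, e⟩ := hfh.exists_pow_eq i
    refine ⟨n, ?_⟩
    rw [← map_pow, e, map_add, map_mul, map_mul]
    refine add_mem (Ideal.mul_mem_left _ _ ?_) (Ideal.mul_mem_left _ _ ?_)
    · exact Ideal.span_mono (by simp) hg
    · exact Ideal.subset_span (by simp)
  intro i
  have : X i = C (g' 0 i) * CubicOrbits.linearSubst g (X 0) +
      C (g' 1 i) * CubicOrbits.linearSubst g (X 1) := by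
    have := congrArg (fun φ => φ (X i)) ((linearSubst_comp g g').trans
      (by rw [h2, linearSubst_one]))
    simpa [linearSubst_X, linearSubst_C] using this.symm
  rw [this]
  exact add_mem (Ideal.mul_mem_left _ _ (hX 0)) (Ideal.mul_mem_left _ _ (hX 1))

/-- The type of the algebra of global sections is invariant under changes of variables and
scaling. -/
lemma IsTransform.isTypeOneTwo {f f' : BinaryCubic k} {g : Matrix.GeneralLinearGroup (Fin 2) k}
    (h : IsTransform f f' g) (hf : disc f ≠ 0) (hL : IsTypeOneTwo k (globalSections f)) :
    IsTypeOneTwo k (globalSections f') := by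
  obtain ⟨c, hc, e⟩ := h
  have hcc : (C c⁻¹ * C c : MvPolynomial (Fin 2) k) = 1 := by
    rw [← C_mul, inv_mul_cancel₀ hc, C_1]
  have h1 : g⁻¹.1 * g.1 = 1 := g.inv_mul
  have h2 : g.1 * g⁻¹.1 = 1 := g.mul_inv
  have hg : linearSubst g.1 f.1 ∈ Ideal.span {f'.1} :=
    Ideal.mem_span_singleton.2 ⟨C c⁻¹, by rw [e, mul_right_comm, mul_comm (C c), hcc, one_mul]⟩
  have hg' : linearSubst g⁻¹.1 f'.1 ∈ Ideal.span {f.1} :=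
    Ideal.mem_span_singleton.2 ⟨C c, by
      rw [e, map_mul, linearSubst_C, ← AlgHom.comp_apply, linearSubst_comp, h1, linearSubst_one,
        mul_comm]
      rfl⟩
  obtain ⟨α, β, γ, hfh⟩ := exists_isTransversal f hf
  have hh := isHomogeneous_binaryQuadratic α β γ
  obtain ⟨e₁, he₁⟩ := hfh.exists_globalSections_equiv two_pos hh
  obtain ⟨e₂, he₂⟩ := (hfh.linearSubst hg h2).exists_globalSections_equiv two_pos
    (linearSubst_isHomogeneous _ hh)
  obtain ⟨e₃, he₃⟩ := exists_away_equiv hg hg' h1 h2 (binaryQuadratic α β γ)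
  obtain ⟨F, _, _, hF, hsep, ⟨i⟩⟩ := hL
  refine ⟨F, _, _, hF, hsep, ⟨AlgEquiv.trans (AlgEquiv.ofRingEquiv
    (f := (e₂.trans e₃.symm).trans e₁.symm) fun r => ?_) i⟩⟩
  change e₁.symm (e₃.symm (e₂ _)) = _
  rw [he₂, ← he₃, e₃.symm_apply_apply, ← he₁, e₁.symm_apply_apply]

end Substitution

/-! ### From a covariant cubic form to a contracted product -/

section Covariant

variable {k : Type u} [Field k]

lemma coeffs_b_ne_zero {f : BinaryCubic k} (hf : disc f ≠ 0) (ha : (coeffs f).a = 0) :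
    (coeffs f).b ≠ 0 := fun hb => hf <| by
  rw [disc_eq_discr, Cubic.discr, ha, hb]
  ring

lemma coeffs_a_eq_eval (f : BinaryCubic k) : (coeffs f).a = eval ![1, 0] f.1 := by
  simp [eval_eq_cubicVal, cubicVal]

lemma exists_generalLinear_row_eq {p : Fin 2 → k} (hp : p ≠ 0) :
    ∃ g : Matrix.GeneralLinearGroup (Fin 2) k, g.1 0 = p := by
  by_cases h0 : p 0 = 0
  · have h1 : p 1 ≠ 0 := fun h1 => hp <| funext <| Fin.forall_fin_two.2 ⟨h0, h1⟩
    refine ⟨Matrix.GeneralLinearGroup.mkOfDetNeZero !![p 0, p 1; 1, 0] ?_, ?_⟩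
    · simpa [Matrix.det_fin_two] using h1
    · exact funext <| Fin.forall_fin_two.2 ⟨rfl, rfl⟩
  · refine ⟨Matrix.GeneralLinearGroup.mkOfDetNeZero !![p 0, p 1; 0, 1] ?_, ?_⟩
    · simpa [Matrix.det_fin_two] using h0
    · exact funext <| Fin.forall_fin_two.2 ⟨rfl, rfl⟩

lemma generalLinear_row_ne_zero (g : Matrix.GeneralLinearGroup (Fin 2) k) : g.1 0 ≠ 0 := fun h => by
  have := (Matrix.isUnit_iff_isUnit_det _).1 g.isUnit
  rw [Matrix.det_fin_two, h] at this
  simp at this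

variable {Y : Type v} [AddCommGroup Y] [Module k Y] {G₁ : Type*} [Group G₁] [DistribMulAction G₁ Y]
  [SMulCommClass G₁ k Y]

lemma pair_smul_fst (g : G₁ × Matrix.GeneralLinearGroup (Fin 2) k) (x : Pair Y) :
    (g • x).1 = g.1 • (g.2.1 0 0 • x.1 + g.2.1 0 1 • x.2) := rfl

lemma one_prod_smul (g : Matrix.GeneralLinearGroup (Fin 2) k) (x : Pair Y) :
    (((1, g) : G₁ × _) • x).1 = g.1 0 0 • x.1 + g.1 0 1 • x.2 ∧
      (((1, g) : G₁ × _) • x).2 = g.1 1 0 • x.1 + g.1 1 1 • x.2 :=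
  ⟨one_smul _ _, one_smul _ _⟩

lemma prod_one_smul (g : G₁) (x : Pair Y) :
    ((g, (1 : Matrix.GeneralLinearGroup (Fin 2) k)) • x).1 = g • x.1 ∧
      ((g, (1 : Matrix.GeneralLinearGroup (Fin 2) k)) • x).2 = g • x.2 := by
  constructor
  · change g • ((1 : Matrix (Fin 2) (Fin 2) k) 0 0 • x.1 +
      (1 : Matrix (Fin 2) (Fin 2) k) 0 1 • x.2) = g • x.1
    simp
  · change g • ((1 : Matrix (Fin 2) (Fin 2) k) 1 0 • x.1 +
      (1 : Matrix (Fin 2) (Fin 2) k) 1 1 • x.2) = g • x.2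
    simp

lemma mem_firstIn {Z : Submodule k Y} {x : Pair Y} : x ∈ firstIn Z ↔ x.1 ∈ Z :=
  ⟨fun h => h.1, fun h => ⟨h, trivial⟩⟩

/-- The orbit structure of the set of all `x` whose form has type `(1, 2)`, for a form `x ↦ F_x`
that is covariant under `G₁ × GL₂(k)`. The last two hypotheses say that every `y` at which the
cubic form on `Y` has a simple zero can be moved into `Z`, and that all elements moving such a
`y ∈ Z` into `Z` are in `P₁`. -/
theorem contractedProduct_of_covariant (form : Pair Y → BinaryCubic k) (P₁ : Subgroup G₁)
    (Z : Submodule k Y)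
    (hsubst : ∀ (g : Matrix.GeneralLinearGroup (Fin 2) k) (x : Pair Y),
      (form (((1, g) : G₁ × _) • x)).1 = linearSubst g.1 (form x).1)
    (hscale : ∀ (g : G₁) (x : Pair Y), disc (form x) ≠ 0 → ∃ c : k, c ≠ 0 ∧
      (form ((g, (1 : Matrix.GeneralLinearGroup (Fin 2) k)) • x)).1 = C c * (form x).1)
    (hZ : ∀ p ∈ P₁, ∀ z ∈ Z, p • z ∈ Z)
    (hzero : ∀ x : Pair Y, x.1 ∈ Z → (coeffs (form x)).a = 0)
    (hred : ∀ x : Pair Y, (coeffs (form x)).a = 0 → (coeffs (form x)).b ≠ 0 →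
      ∃ g : G₁, g • x.1 ∈ Z)
    (hstab : ∀ x : Pair Y, (coeffs (form x)).b ≠ 0 → x.1 ∈ Z → ∀ g : G₁, g • x.1 ∈ Z → g ∈ P₁) :
    (∀ p ∈ P₁.prod (B2 k), ∀ w ∈ firstIn Z, p • w ∈ firstIn Z) ∧
    EqContractedProduct (typeOneTwoSet form) (P₁.prod (B2 k))
      ((firstIn Z : Set (Pair Y)) ∩ typeOneTwoSet form) ∧
    (∀ x ∈ typeOneTwoSet form, ∃ g : G₁ × Matrix.GeneralLinearGroup (Fin 2) k,
      g • x ∈ firstIn Z) ∧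
    (∀ w ∈ (firstIn Z : Set (Pair Y)) ∩ typeOneTwoSet form,
      ∀ w' ∈ (firstIn Z : Set (Pair Y)) ∩ typeOneTwoSet form,
      (∃ g : G₁ × Matrix.GeneralLinearGroup (Fin 2) k, g • w = w') →
        ∃ p ∈ P₁.prod (B2 k), p • w = w') := by
  have htrans : ∀ (g : G₁ × Matrix.GeneralLinearGroup (Fin 2) k) (x : Pair Y),
      disc (form x) ≠ 0 → IsTransform (form x) (form (g • x)) g.2 := by
    rintro ⟨g₁, g₂⟩ x hx
    have h2 : IsTransform (form x) (form (((1, g₂) : G₁ × _) • x)) g₂ :=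
      ⟨1, one_ne_zero, by rw [hsubst, C_1, one_mul]⟩
    obtain ⟨c, hc, e⟩ := hscale g₁ _ (h2.disc_ne_zero hx)
    refine ⟨c, hc, ?_⟩
    rw [← hsubst, ← e, ← mul_smul, Prod.mk_mul_mk, mul_one, one_mul]
  have hV : ∀ (g : G₁ × Matrix.GeneralLinearGroup (Fin 2) k), ∀ x ∈ typeOneTwoSet form,
      g • x ∈ typeOneTwoSet form := fun g x hx =>
    ⟨(htrans g x hx.1).disc_ne_zero hx.1, (htrans g x hx.1).isTypeOneTwo hx.1 hx.2⟩
  have hW : ∀ p ∈ P₁.prod (B2 k), ∀ w ∈ firstIn Z, p • w ∈ firstIn Z := by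
    rintro p ⟨hp1, hp2⟩ w hw
    have hp2 : p.2.1 0 1 = 0 := hp2
    rw [mem_firstIn] at hw ⊢
    rw [pair_smul_fst, hp2, zero_smul, add_zero]
    exact hZ _ hp1 _ (Z.smul_mem _ hw)
  -- The zero `(1, 0)` of `F_w` is the only rational one, so `g` must fix it.
  have hP : ∀ w ∈ (firstIn Z : Set (Pair Y)) ∩ typeOneTwoSet form,
      ∀ g : G₁ × Matrix.GeneralLinearGroup (Fin 2) k, g • w ∈ firstIn Z → g ∈ P₁.prod (B2 k) := by
    rintro w ⟨hwW, hw⟩ g hg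
    rw [SetLike.mem_coe, mem_firstIn] at hwW
    rw [mem_firstIn] at hg
    have ha := hzero w hwW
    obtain ⟨c, hc, e⟩ := htrans g w hw.1
    have h0 : eval (g.2.1 0) (form w).1 = 0 := by
      have := hzero _ hg
      rw [coeffs_a_eq_eval, e, map_mul, eval_C, eval_linearSubst] at this
      have hrow : Matrix.vecMul ![1, 0] g.2.1 = g.2.1 0 := by
        ext i
        simp [Matrix.vecMul, dotProduct]
      rw [hrow] at this
      exact (mul_eq_zero.1 this).resolve_left hc
    have h1 := (exists_unique_zero hw.1 hw.2).2 ![1, 0] (g.2.1 0)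
      (fun h => one_ne_zero (congrFun h 0)) (generalLinear_row_ne_zero _)
      (by rw [← coeffs_a_eq_eval, ha]) h0
    have h01 : g.2.1 0 1 = 0 := by simpa using h1
    have h00 : g.2.1 0 0 ≠ 0 := fun h =>
      generalLinear_row_ne_zero g.2 (funext <| Fin.forall_fin_two.2 ⟨h, h01⟩)
    refine ⟨hstab w (coeffs_b_ne_zero hw.1 ha) hwW g.1 ?_, h01⟩
    rw [pair_smul_fst, h01, zero_smul, add_zero, smul_comm] at hg
    exact (Z.smul_mem_iff h00).1 hg
  have hmeet : ∀ x ∈ typeOneTwoSet form, ∃ g : G₁ × Matrix.GeneralLinearGroup (Fin 2) k,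
      g • x ∈ firstIn Z := by
    intro x hx
    obtain ⟨p, hp, hpx⟩ := (exists_unique_zero hx.1 hx.2).1
    obtain ⟨g₂, rfl⟩ := exists_generalLinear_row_eq hp
    have hx' := hV (1, g₂) x hx
    have ha : (coeffs (form (((1, g₂) : G₁ × _) • x))).a = 0 := by
      have hrow : Matrix.vecMul ![1, 0] g₂.1 = g₂.1 0 := by
        ext i
        simp [Matrix.vecMul, dotProduct]
      rw [coeffs_a_eq_eval, hsubst, eval_linearSubst, hrow, hpx]
    obtain ⟨g₁, hg₁⟩ := hred _ ha (coeffs_b_ne_zero hx'.1 ha)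
    refine ⟨(g₁, 1) * (1, g₂), ?_⟩
    rw [mul_smul, mem_firstIn, pair_smul_fst]
    simpa using hg₁
  refine ⟨hW, ⟨fun p hp s hs => ⟨hW p hp s hs.1, hV p s hs.2⟩, ?_, ?_, ?_⟩, hmeet, ?_⟩
  · rintro ⟨g, s⟩ -
    exact hV g s s.2.2
  · rintro ⟨g, s⟩ - ⟨g', s'⟩ - h
    replace h : g • (s : Pair Y) = g' • (s' : Pair Y) := h
    have h' : (s' : Pair Y) = (g'⁻¹ * g) • (s : Pair Y) := by
      rw [mul_smul, h, inv_smul_smul]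
    refine Quotient.sound ⟨g'⁻¹ * g, hP s s.2 _ (h' ▸ s'.2.1), ?_, h'⟩
    simp
  · intro x hx
    obtain ⟨g, hg⟩ := hmeet x hx
    exact ⟨Quotient.mk _ (g⁻¹, ⟨g • x, hg, hV g x hx⟩), trivial, inv_smul_smul g x⟩
  · rintro w hw w' hw' ⟨g, rfl⟩
    exact ⟨g, hP w hw g hw'.1, rfl⟩

end Covariant

/-! ### Determinants of pencils of matrices over a field -/

section Determinant

variable {F : Type*} [Field F]

lemma exists_unit_matrix_row_eq {p : Fin 3 → F} (hp : p ≠ 0) : ∃ g : GL3 F, g.1 0 = p := by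
  obtain ⟨i, hi⟩ := Function.ne_iff.1 hp
  have key : ∀ M : Matrix (Fin 3) (Fin 3) F, M.det ≠ 0 → M 0 = p → ∃ g : GL3 F, g.1 0 = p :=
    fun M hM h => ⟨Matrix.GeneralLinearGroup.mkOfDetNeZero M hM, h⟩
  have hrow : ∀ r s : Fin 3 → F, Matrix.of ![p, r, s] 0 = p := fun _ _ => rfl
  fin_cases i
  · refine key (Matrix.of ![p, ![0, 1, 0], ![0, 0, 1]]) ?_ (hrow _ _)
    simpa [Matrix.det_fin_three] using hi
  · refine key (Matrix.of ![p, ![1, 0, 0], ![0, 0, 1]]) ?_ (hrow _ _)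
    simpa [Matrix.det_fin_three] using hi
  · refine key (Matrix.of ![p, ![1, 0, 0], ![0, 1, 0]]) ?_ (hrow _ _)
    simpa [Matrix.det_fin_three] using hi

lemma exists_unit_matrix_mul_row_eq_zero {y : Matrix (Fin 3) (Fin 3) F} (hy : y.det = 0) :
    ∃ g : GL3 F, ∀ j, (g.1 * y) 0 j = 0 := by
  obtain ⟨p, hp, hpy⟩ := Matrix.exists_vecMul_eq_zero_iff.2 hy
  obtain ⟨g, rfl⟩ := exists_unit_matrix_row_eq hp
  exact ⟨g, fun j => congrFun hpy j⟩

/-- Row version of the stabilizer computation: the left kernel of a matrix `0 ⊕ y'` with `y'`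
invertible is spanned by the first basis vector. -/
lemma row_eq_zero_of_mul_row_eq_zero {y : Matrix (Fin 3) (Fin 3) F}
    (hy : ∀ i, y 0 i = 0) (hdet : y 1 1 * y 2 2 - y 1 2 * y 2 1 ≠ 0)
    {g : Matrix (Fin 3) (Fin 3) F} {M : GL3 F} (h : ∀ j, (g * y * M.1) 0 j = 0) :
    g 0 1 = 0 ∧ g 0 2 = 0 := by
  have h' : ∀ j, (g * y) 0 j = 0 := fun j => by
    have e : g * y = g * y * M.1 * M⁻¹.1 := by
      rw [Matrix.mul_assoc (g * y), ← Units.val_mul, mul_inv_cancel, Units.val_one, Matrix.mul_one]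
    rw [e, Matrix.mul_apply]
    exact Finset.sum_eq_zero fun l _ => by rw [h, zero_mul]
  have h1 := h' 1
  have h2 := h' 2
  simp only [Matrix.mul_apply, Fin.sum_univ_three, hy, mul_zero, zero_add] at h1 h2
  refine ⟨(mul_eq_zero.1 ?_).resolve_right hdet, (mul_eq_zero.1 ?_).resolve_right hdet⟩
  · linear_combination y 2 2 * h1 - y 2 1 * h2
  · linear_combination y 1 1 * h2 - y 1 2 * h1

lemma linearMatrix_linearSubst (g : Matrix (Fin 2) (Fin 2) F) (x₁ x₂ : Matrix (Fin 3) (Fin 3) F) :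
    (linearMatrix (g 0 0 • x₁ + g 0 1 • x₂) (g 1 0 • x₁ + g 1 1 • x₂)).det =
      linearSubst g (linearMatrix x₁ x₂).det := by
  rw [AlgHom.map_det]
  congr 1
  ext1 i j
  simp only [linearMatrix, Matrix.of_apply, Matrix.add_apply, Matrix.smul_apply, smul_eq_mul,
    AlgHom.mapMatrix_apply, Matrix.map_apply, map_add, map_mul, linearSubst_X, linearSubst_C]
  ring

lemma det_linearMatrix_mul (g h x₁ x₂ : Matrix (Fin 3) (Fin 3) F) :
    (linearMatrix (g * x₁ * h) (g * x₂ * h)).det =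
      C (g.det * h.det) * (linearMatrix x₁ x₂).det := by
  have e : linearMatrix (g * x₁ * h) (g * x₂ * h) = g.map C * linearMatrix x₁ x₂ * h.map C := by
    ext1 i j
    simp only [linearMatrix, Matrix.of_apply, Matrix.mul_apply, Fin.sum_univ_three,
      Matrix.map_apply, map_add, map_mul]
    ring
  rw [e, Matrix.det_mul, Matrix.det_mul, ← RingHom.mapMatrix_apply, ← RingHom.mapMatrix_apply,
    ← RingHom.map_det, ← RingHom.map_det, C_mul]
  ring

lemma eval_det_linearMatrix (x₁ x₂ : Matrix (Fin 3) (Fin 3) F) :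
    eval ![1, 0] (linearMatrix x₁ x₂).det = x₁.det := by
  rw [RingHom.map_det]
  congr 1
  ext1 i j
  simp [linearMatrix]

lemma coeffs_b_eq_eval (f : BinaryCubic F) : (coeffs f).b = eval ![1, 0] (pderiv 1 f.1) := by
  conv_rhs => rw [← homogenized_coeffs f]
  simp [homogenized, pderiv_X]

lemma eval_pderiv_det_linearMatrix {x₁ : Matrix (Fin 3) (Fin 3) F}
    (h : ∀ i, x₁ 0 i = 0 ∧ x₁ i 0 = 0) (x₂ : Matrix (Fin 3) (Fin 3) F) :
    eval ![1, 0] (pderiv 1 (linearMatrix x₁ x₂).det) =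
      x₂ 0 0 * (x₁ 1 1 * x₁ 2 2 - x₁ 1 2 * x₁ 2 1) := by
  rw [Matrix.det_fin_three]
  simp [linearMatrix, pderiv_X, Derivation.leibniz, (h _).1, (h _).2]
  ring

end Determinant

/-! ### Pairs of `3 × 3` matrices -/

section CaseA

variable {k : Type u} [Field k]

theorem contractedProduct_matrices :
    (∀ p ∈ PA k, ∀ w ∈ WA k, p • w ∈ WA k) ∧
      EqContractedProduct (V2A k) (PA k) (W2A k) ∧
      (∀ x ∈ V2A k, ∃ g : GA k, g • x ∈ WA k) ∧
      (∀ w ∈ W2A k, ∀ w' ∈ W2A k, (∃ g : GA k, g • w = w') → ∃ p ∈ PA k, p • w = w') := by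
  have hsmul : ∀ (g : GL3 k × GL3 k) (y : YA k), g • y = g.1.1 * y * g.2.1.transpose :=
    fun _ _ => rfl
  have htr : ∀ g : GL3 k, ∃ h : GL3 k, h.1 = g.1.transpose := fun g =>
    ⟨⟨g.1.transpose, g⁻¹.1.transpose,
      by rw [← Matrix.transpose_mul, g.inv_mul, Matrix.transpose_one],
      by rw [← Matrix.transpose_mul, g.mul_inv, Matrix.transpose_one]⟩, rfl⟩
  have hdet : ∀ g : GL3 k, g.1.det ≠ 0 := fun g =>
    ((Matrix.isUnit_iff_isUnit_det _).1 g.isUnit).ne_zero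
  refine contractedProduct_of_covariant formA ((P12 k).prod (P12 k)) (ZA k) ?_ ?_ ?_ ?_ ?_ ?_
  · intro g x
    refine Eq.trans ?_ (linearMatrix_linearSubst g.1 x.1 x.2)
    exact congrArg₂ (fun y z => (linearMatrix y z).det) (one_prod_smul g x).1 (one_prod_smul g x).2
  · intro g x _
    refine ⟨g.1.1.det * g.2.1.transpose.det, ?_, ?_⟩
    · rw [Matrix.det_transpose]
      exact mul_ne_zero (hdet _) (hdet _)
    · refine Eq.trans ?_ (det_linearMatrix_mul _ _ x.1 x.2)
      exact congrArg₂ (fun y z => (linearMatrix y z).det) (prod_one_smul g x).1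
        (prod_one_smul g x).2
  · rintro ⟨g, h⟩ ⟨⟨hg1, hg2⟩, hh1, hh2⟩ z hz i
    have hz' : ∀ i, z 0 i = 0 ∧ z i 0 = 0 := hz
    rw [hsmul]
    simp only at hg1 hg2 hh1 hh2
    simp [Matrix.mul_apply, Fin.sum_univ_three, hg1, hg2, hh1, hh2, (hz' _).1, (hz' _).2]
  · intro x hx
    rw [coeffs_a_eq_eval, formA, eval_det_linearMatrix]
    exact Matrix.det_eq_zero_of_row_eq_zero 0 fun i => (hx i).1
  · intro x hx _
    rw [coeffs_a_eq_eval, formA, eval_det_linearMatrix] at hx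
    obtain ⟨g, hg⟩ := exists_unit_matrix_mul_row_eq_zero hx
    obtain ⟨h, hh⟩ := exists_unit_matrix_mul_row_eq_zero ((Matrix.det_transpose x.1).trans hx)
    refine ⟨(g, h), fun i => ?_⟩
    rw [hsmul]
    constructor
    · rw [Matrix.mul_apply]
      exact Finset.sum_eq_zero fun l _ => by rw [hg, zero_mul]
    · rw [← Matrix.transpose_apply (g.1 * x.1 * _), Matrix.mul_assoc, Matrix.transpose_mul,
        Matrix.transpose_mul, Matrix.transpose_transpose, Matrix.mul_apply]
      exact Finset.sum_eq_zero fun l _ => by rw [hh, zero_mul]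
  · rintro x hb hx ⟨g, h⟩ hgx
    have hx' : ∀ i, x.1 0 i = 0 ∧ x.1 i 0 = 0 := hx
    have hgx' : ∀ i, (g.1 * x.1 * h.1.transpose) 0 i = 0 ∧
        (g.1 * x.1 * h.1.transpose) i 0 = 0 := hgx
    rw [coeffs_b_eq_eval, formA, eval_pderiv_det_linearMatrix hx'] at hb
    have hδ := right_ne_zero_of_mul hb
    obtain ⟨h', hh'⟩ := htr h
    obtain ⟨g', hg'⟩ := htr g
    refine ⟨row_eq_zero_of_mul_row_eq_zero (fun i => (hx' i).1) hδ (M := h') fun j => ?_,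
      row_eq_zero_of_mul_row_eq_zero (y := x.1.transpose) (fun i => (hx' i).2) ?_ (M := g')
        fun j => ?_⟩
    · rw [hh']
      exact (hgx' j).1
    · simpa [mul_comm] using hδ
    · rw [hg', Matrix.mul_assoc, ← Matrix.transpose_mul,
        ← Matrix.transpose_transpose h.1, ← Matrix.transpose_mul]
      exact (hgx' j).2

end CaseA

/-! ### Pairs of Hermitian forms over a quadratic extension -/

section CaseB

variable {k : Type u} [Field k] {F : Type v} [Field F] [Algebra k F] (σ : F ≃ₐ[k] F)

lemma map_linearSubst (g : Matrix (Fin 2) (Fin 2) k) (p : MvPolynomial (Fin 2) k) :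
    MvPolynomial.map (algebraMap k F) (linearSubst g p) =
      linearSubst (g.map (algebraMap k F)) (MvPolynomial.map (algebraMap k F) p) := by
  induction p using MvPolynomial.induction_on with
  | C r => simp only [linearSubst_C, map_C]
  | add p q hp hq => simp only [map_add, hp, hq]
  | mul_X p i hp => simp only [map_mul, hp, linearSubst_X, map_add, map_C, map_X, Matrix.map_apply]

lemma eval_one_zero_map (p : MvPolynomial (Fin 2) k) :
    eval ![1, 0] (MvPolynomial.map (algebraMap k F) p) = algebraMap k F (eval ![1, 0] p) := by
  induction p using MvPolynomial.induction_on with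
  | C r => simp only [map_C, eval_C]
  | add p q hp hq => simp only [map_add, hp, hq]
  | mul_X p i hp =>
    simp only [map_mul, hp, map_X, eval_X]
    fin_cases i <;> simp

variable [hσ : IsQuadraticConj σ]

lemma algebraMap_coeffs_a_formB (x : Pair (YB σ)) :
    algebraMap k F (coeffs (formB σ x)).a = x.1.1.det := by
  rw [← eval_det_linearMatrix x.1.1 x.2.1, ← map_formB, coeffs_a_eq_eval,
    eval_one_zero_map]

lemma algebraMap_coeffs_b_formB {x : Pair (YB σ)} (hx : x.1 ∈ ZB σ) :
    algebraMap k F (coeffs (formB σ x)).b =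
      x.2.1 0 0 * (x.1.1 1 1 * x.1.1 2 2 - x.1.1 1 2 * x.1.1 2 1) := by
  rw [← eval_pderiv_det_linearMatrix hx, ← map_formB, coeffs_b_eq_eval, pderiv_map,
    eval_one_zero_map]

theorem contractedProduct_hermitian :
    (∀ p ∈ PB k F, ∀ w ∈ WB σ, p • w ∈ WB σ) ∧
      EqContractedProduct (V2B σ) (PB k F) (W2B σ) ∧
      (∀ x ∈ V2B σ, ∃ g : GB k F, g • x ∈ WB σ) ∧
      (∀ w ∈ W2B σ, ∀ w' ∈ W2B σ, (∃ g : GB k F, g • w = w') → ∃ p ∈ PB k F, p • w = w') := by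
  have hsmul : ∀ (g : GL3 F) (y : YB σ), (g • y).1 = g.1 * y.1 * conjT σ g.1 := fun _ _ => rfl
  have hherm : ∀ (y : YB σ) (i j), σ (y.1 i j) = y.1 j i := fun y i j =>
    congrFun (congrFun (show conjT σ y.1 = y.1 from y.2) j) i
  have hZB : ∀ y : YB σ, (∀ i, y.1 0 i = 0) → y ∈ ZB σ := fun y hy i =>
    ⟨hy i, by rw [← hherm, hy, map_zero]⟩
  have hinj : Function.Injective (MvPolynomial.map (σ := Fin 2) (algebraMap k F)) :=
    map_injective _ (algebraMap k F).injective
  refine contractedProduct_of_covariant (formB σ) (P12 F) (ZB σ) ?_ ?_ ?_ ?_ ?_ ?_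
  · intro g x
    apply hinj
    rw [map_formB, map_linearSubst, map_formB, ← linearMatrix_linearSubst,
      (one_prod_smul g x).1, (one_prod_smul g x).2]
    simp only [Matrix.map_apply, algebraMap_smul]
    rfl
  · intro g x _
    -- The determinant of `g` contributes its norm `det g * σ (det g)`.
    have hconj : (conjT σ g.1).det = σ g.1.det := by
      rw [conjT, Matrix.det_transpose, AlgEquiv.map_det]
      rfl
    obtain ⟨c, hc⟩ := mem_range_of_conj_eq σ (a := g.1.det * (conjT σ g.1).det) (by
      rw [hconj, map_mul, conj_conj, mul_comm])
    refine ⟨c, ?_, ?_⟩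
    · rintro rfl
      have hg : g.1.det ≠ 0 := ((Matrix.isUnit_iff_isUnit_det _).1 g.isUnit).ne_zero
      rw [map_zero, hconj] at hc
      exact mul_ne_zero hg ((map_ne_zero σ).2 hg) hc.symm
    · apply hinj
      rw [map_mul, map_C, map_formB, map_formB, hc, ← det_linearMatrix_mul,
        (prod_one_smul g x).1, (prod_one_smul g x).2, hsmul, hsmul]
  · rintro g ⟨hg1, hg2⟩ z hz
    refine hZB _ fun i => ?_
    have hz' : ∀ i, z.1 0 i = 0 ∧ z.1 i 0 = 0 := hz
    rw [hsmul]
    simp [Matrix.mul_apply, Fin.sum_univ_three, hg1, hg2, (hz' _).1]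
  · intro x hx
    refine (algebraMap k F).injective ?_
    rw [algebraMap_coeffs_a_formB, map_zero]
    exact Matrix.det_eq_zero_of_row_eq_zero 0 fun i => (hx i).1
  · intro x hx _
    have hdet : x.1.1.det = 0 := by rw [← algebraMap_coeffs_a_formB, hx, map_zero]
    obtain ⟨g, hg⟩ := exists_unit_matrix_mul_row_eq_zero hdet
    refine ⟨g, hZB _ fun i => ?_⟩
    rw [hsmul, Matrix.mul_apply]
    exact Finset.sum_eq_zero fun l _ => by rw [hg, zero_mul]
  · intro x hb hx g hgx
    have hδ : x.1.1 1 1 * x.1.1 2 2 - x.1.1 1 2 * x.1.1 2 1 ≠ 0 := fun h0 => hb <| by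
      refine (algebraMap k F).injective ?_
      rw [algebraMap_coeffs_b_formB σ hx, h0, mul_zero, map_zero]
    let M : GL3 F := ⟨conjT σ g.1, conjT σ g⁻¹.1, by rw [← conjT_mul, g.inv_mul, conjT_one],
      by rw [← conjT_mul, g.mul_inv, conjT_one]⟩
    exact row_eq_zero_of_mul_row_eq_zero (fun i => (hx i).1) hδ (M := M) fun j => (hgx j).1

end CaseB

/-! ### Hermitian matrices over quaternion algebras -/

section Quaternion

open Quaternion

variable {R : Type*} [CommRing R] {a b c : R}

/-- A Hermitian `3 × 3` matrix `(r₁ z y*; z* r₂ x; y x* r₃)` over a quaternion algebra, with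
scalars on the diagonal, given by its six independent entries. -/
@[ext] structure HermitianData (R : Type*) [CommRing R] (a b c : R) where
  r₁ : R
  r₂ : R
  r₃ : R
  x : ℍ[R,a,b,c]
  y : ℍ[R,a,b,c]
  z : ℍ[R,a,b,c]

namespace HermitianData

/-- The matrix with the given entries. -/
def toMatrix (h : HermitianData R a b c) : Matrix (Fin 3) (Fin 3) ℍ[R,a,b,c] :=
  !![algebraMap R _ h.r₁, h.z, star h.y; star h.z, algebraMap R _ h.r₂, h.x;
    h.y, star h.x, algebraMap R _ h.r₃]

/-- The Pfaffian of the matrix. -/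
def pf (h : HermitianData R a b c) : R :=
  h.r₁ * h.r₂ * h.r₃ - h.r₁ * qNorm h.x - h.r₂ * qNorm h.y - h.r₃ * qNorm h.z +
    qTrace (h.z * h.x * h.y)

/-- The quadratic adjoint, the analogue of the adjugate matrix. -/
def adj (h : HermitianData R a b c) : HermitianData R a b c where
  r₁ := h.r₂ * h.r₃ - qNorm h.x
  r₂ := h.r₃ * h.r₁ - qNorm h.y
  r₃ := h.r₁ * h.r₂ - qNorm h.z
  x := star (h.y * h.z) - h.r₁ • h.x
  y := star (h.z * h.x) - h.r₂ • h.y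
  z := star (h.x * h.y) - h.r₃ • h.z

lemma pfaff3_toMatrix (h : HermitianData R a b c) : pfaff3 h.toMatrix = h.pf := by
  simp [pfaff3, toMatrix, pf, QuaternionAlgebra.algebraMap_eq]

lemma conjTranspose_toMatrix (h : HermitianData R a b c) :
    h.toMatrix.conjTranspose = h.toMatrix := by
  ext1 i j
  fin_cases i <;> fin_cases j <;> simp [toMatrix, QuaternionAlgebra.algebraMap_eq]

lemma toMatrix_mul_toMatrix_adj (h : HermitianData R a b c) :
    h.toMatrix * h.adj.toMatrix = h.pf • (1 : Matrix (Fin 3) (Fin 3) ℍ[R,a,b,c]) := by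
  obtain ⟨r₁, r₂, r₃, ⟨x0, x1, x2, x3⟩, ⟨y0, y1, y2, y3⟩, ⟨z0, z1, z2, z3⟩⟩ := h
  rw [Matrix.one_fin_three, Matrix.smul_of, toMatrix, toMatrix, Matrix.mul_fin_three]
  simp only [Matrix.smul_cons, smul_zero, Matrix.smul_empty, adj, pf, qNorm, qTrace]
  refine congrArg Matrix.of (congrArg₂ Matrix.vecCons ?_ (congrArg₂ Matrix.vecCons ?_
    (congrArg₂ Matrix.vecCons ?_ rfl))) <;>
  refine congrArg₂ Matrix.vecCons ?_ (congrArg₂ Matrix.vecCons ?_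
    (congrArg₂ Matrix.vecCons ?_ rfl)) <;> ext <;>
  simp only [QuaternionAlgebra.algebraMap_eq, QuaternionAlgebra.re_mul, QuaternionAlgebra.imI_mul,
    QuaternionAlgebra.imJ_mul, QuaternionAlgebra.imK_mul, QuaternionAlgebra.re_add,
    QuaternionAlgebra.imI_add, QuaternionAlgebra.imJ_add, QuaternionAlgebra.imK_add,
    QuaternionAlgebra.re_sub,
    QuaternionAlgebra.imI_sub, QuaternionAlgebra.imJ_sub, QuaternionAlgebra.imK_sub,
    QuaternionAlgebra.re_smul,
    QuaternionAlgebra.imI_smul, QuaternionAlgebra.imJ_smul, QuaternionAlgebra.imK_smul,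
    QuaternionAlgebra.re_star,
    QuaternionAlgebra.imI_star, QuaternionAlgebra.imJ_star, QuaternionAlgebra.imK_star,
    QuaternionAlgebra.re_one, QuaternionAlgebra.imI_one, QuaternionAlgebra.imJ_one,
    QuaternionAlgebra.imK_one, QuaternionAlgebra.re_zero, QuaternionAlgebra.imI_zero,
    QuaternionAlgebra.imJ_zero, QuaternionAlgebra.imK_zero, smul_eq_mul] <;> ring

lemma toMatrix_adj_mul_toMatrix (h : HermitianData R a b c) :
    h.adj.toMatrix * h.toMatrix = h.pf • (1 : Matrix (Fin 3) (Fin 3) ℍ[R,a,b,c]) := by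
  have := congrArg Matrix.conjTranspose h.toMatrix_mul_toMatrix_adj
  rw [Matrix.conjTranspose_mul, conjTranspose_toMatrix, conjTranspose_toMatrix] at this
  rw [this]
  ext1 i j
  fin_cases i <;> fin_cases j <;> simp [Matrix.conjTranspose_apply]

/-- The trace form `h ↦ tr (m h)` on Hermitian matrices, for a Hermitian matrix `m`; the entries of
`m` used here are those that correspond to `r₁, r₂, r₃, x, y, z`. -/
def traceForm (m : Matrix (Fin 3) (Fin 3) ℍ[R,a,b,c]) (h : HermitianData R a b c) : R :=
  (m 0 0).re * h.r₁ + (m 1 1).re * h.r₂ + (m 2 2).re * h.r₃ +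
    qTrace (m 1 2 * star h.x) + qTrace (m 2 0 * star h.y) + qTrace (m 0 1 * star h.z)

lemma traceForm_smul (r : R) (m : Matrix (Fin 3) (Fin 3) ℍ[R,a,b,c]) (h : HermitianData R a b c) :
    traceForm (r • m) h = r * traceForm m h := by
  simp only [traceForm, Matrix.smul_apply, smul_mul_assoc, qTrace, QuaternionAlgebra.re_smul,
    QuaternionAlgebra.re_add, QuaternionAlgebra.re_star, QuaternionAlgebra.imI_smul, smul_eq_mul]
  ring

/-- Apply a derivation to a quaternion coordinatewise. -/
def _root_.CubicOrbits.quaternionDerive {A : Type*} [CommRing A] [Algebra A R]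
    (D : Derivation A R R) (q : ℍ[R,a,b,c]) : ℍ[R,a,b,c] :=
  ⟨D q.re, D q.imI, D q.imJ, D q.imK⟩

/-- Apply a derivation to all entries. -/
def derive {A : Type*} [CommRing A] [Algebra A R] (D : Derivation A R R)
    (h : HermitianData R a b c) : HermitianData R a b c :=
  ⟨D h.r₁, D h.r₂, D h.r₃, quaternionDerive D h.x, quaternionDerive D h.y, quaternionDerive D h.z⟩

/-- The differential of the Pfaffian is given by the adjoint. -/
lemma derivation_pf {A : Type*} [CommRing A] [Algebra A R] (D : Derivation A R R) (ha : D a = 0)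
    (hb : D b = 0) (hc : D c = 0) (h : HermitianData R a b c) :
    D h.pf = traceForm h.adj.toMatrix (h.derive D) := by
  obtain ⟨r₁, r₂, r₃, ⟨x0, x1, x2, x3⟩, ⟨y0, y1, y2, y3⟩, ⟨z0, z1, z2, z3⟩⟩ := h
  simp [pf, qNorm, qTrace, adj, traceForm, derive, quaternionDerive, toMatrix, ha, hb, hc,
    Derivation.leibniz, QuaternionAlgebra.algebraMap_eq]
  ring

/-- The rows of this matrix annihilate `h.toMatrix` if the adjoint vanishes. -/
def annihilator (h : HermitianData R a b c) : Matrix (Fin 3) (Fin 3) ℍ[R,a,b,c] :=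
  !![algebraMap R _ h.r₂, -h.z, 0; 0, algebraMap R _ h.r₃, -h.x; -h.y, 0, algebraMap R _ h.r₁]

lemma annihilator_mul_toMatrix (h : HermitianData R a b c) :
    h.annihilator * h.toMatrix =
      !![algebraMap R _ h.adj.r₃, 0, -star h.adj.y; -star h.adj.z, algebraMap R _ h.adj.r₁, 0;
        0, -star h.adj.x, algebraMap R _ h.adj.r₂] := by
  obtain ⟨r₁, r₂, r₃, ⟨x0, x1, x2, x3⟩, ⟨y0, y1, y2, y3⟩, ⟨z0, z1, z2, z3⟩⟩ := h
  rw [annihilator, toMatrix, Matrix.mul_fin_three]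
  simp only [adj, qNorm]
  refine congrArg Matrix.of (congrArg₂ Matrix.vecCons ?_ (congrArg₂ Matrix.vecCons ?_
    (congrArg₂ Matrix.vecCons ?_ rfl))) <;>
  refine congrArg₂ Matrix.vecCons ?_ (congrArg₂ Matrix.vecCons ?_
    (congrArg₂ Matrix.vecCons ?_ rfl)) <;> ext <;>
  simp only [QuaternionAlgebra.algebraMap_eq, QuaternionAlgebra.re_mul, QuaternionAlgebra.imI_mul,
    QuaternionAlgebra.imJ_mul, QuaternionAlgebra.imK_mul, QuaternionAlgebra.re_add,
    QuaternionAlgebra.imI_add, QuaternionAlgebra.imJ_add, QuaternionAlgebra.imK_add,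
    QuaternionAlgebra.re_sub, QuaternionAlgebra.re_neg,
    QuaternionAlgebra.imI_neg, QuaternionAlgebra.imJ_neg, QuaternionAlgebra.imK_neg,
    QuaternionAlgebra.imI_sub, QuaternionAlgebra.imJ_sub, QuaternionAlgebra.imK_sub,
    QuaternionAlgebra.re_smul,
    QuaternionAlgebra.imI_smul, QuaternionAlgebra.imJ_smul, QuaternionAlgebra.imK_smul,
    QuaternionAlgebra.re_star,
    QuaternionAlgebra.imI_star, QuaternionAlgebra.imJ_star, QuaternionAlgebra.imK_star,
    QuaternionAlgebra.re_zero, QuaternionAlgebra.imI_zero,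
    QuaternionAlgebra.imJ_zero, QuaternionAlgebra.imK_zero, smul_eq_mul] <;> ring

lemma toMatrix_eq_zero_iff {h : HermitianData R a b c} : h.toMatrix = 0 ↔
    (h.r₁ = 0 ∧ h.r₂ = 0 ∧ h.r₃ = 0) ∧ h.x = 0 ∧ h.y = 0 ∧ h.z = 0 := by
  constructor
  · intro hm
    have e : ∀ i j, h.toMatrix i j = 0 := fun i j => by rw [hm]; rfl
    have hinj := QuaternionAlgebra.algebraMap_injective (R := R) (c₁ := a) (c₂ := b) (c₃ := c)
    have hr : ∀ r : R, algebraMap R ℍ[R,a,b,c] r = 0 → r = 0 := fun r hr =>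
      hinj (hr.trans (map_zero _).symm)
    exact ⟨⟨hr _ (e 0 0), hr _ (e 1 1), hr _ (e 2 2)⟩, e 1 2, e 2 0, e 0 1⟩
  · rintro ⟨⟨h1, h2, h3⟩, hx, hy, hz⟩
    rw [toMatrix, h1, h2, h3, hx, hy, hz, map_zero, star_zero]
    ext1 i j
    fin_cases i <;> fin_cases j <;> rfl

/-- A Hermitian matrix that is not a right zero divisor has a nonzero adjoint, unless it is zero. -/
lemma toMatrix_eq_zero_of_adj_eq_zero {h : HermitianData R a b c} (hh : h.adj.toMatrix = 0)
    (hreg : ∀ m : Matrix (Fin 3) (Fin 3) ℍ[R,a,b,c], m * h.toMatrix = 0 → m = 0) :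
    h.toMatrix = 0 := by
  obtain ⟨⟨h1, h2, h3⟩, hx, hy, hz⟩ := toMatrix_eq_zero_iff.1 hh
  have hm : h.annihilator = 0 := hreg _ <| by
    rw [annihilator_mul_toMatrix, h1, h2, h3, hx, hy, hz, map_zero, star_zero, neg_zero]
    ext1 i j
    fin_cases i <;> fin_cases j <;> rfl
  have e : ∀ i j, h.annihilator i j = 0 := fun i j => by rw [hm]; rfl
  have hinj := QuaternionAlgebra.algebraMap_injective (R := R) (c₁ := a) (c₂ := b) (c₃ := c)
  have hr : ∀ r : R, algebraMap R ℍ[R,a,b,c] r = 0 → r = 0 := fun r hr =>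
    hinj (hr.trans (map_zero _).symm)
  exact toMatrix_eq_zero_iff.2 ⟨⟨hr _ (e 2 2), hr _ (e 0 0), hr _ (e 1 1)⟩,
    neg_eq_zero.1 (e 1 2), neg_eq_zero.1 (e 2 0), neg_eq_zero.1 (e 0 1)⟩

end HermitianData

end Quaternion

/-! ### Divisibility by a binary cubic form of nonzero discriminant -/

section Divisibility

variable {k : Type u} [Field k]

lemma dvd_of_dvd_mul_X_pow {F p : MvPolynomial (Fin 2) k} {n : ℕ} (h0 : F ∣ p * X 0 ^ n)
    (h1 : F ∣ p * X 1 ^ n) : F ∣ p := by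
  let _ : GCDMonoid (MvPolynomial (Fin 2) k) :=
    UniqueFactorizationMonoid.toGCDMonoid _
  have hrel : IsRelPrime (X 0 ^ n : MvPolynomial (Fin 2) k) (X 1 ^ n) := by
    refine IsRelPrime.pow ?_
    refine (X_prime (R := k) (i := (0 : Fin 2))).irreducible.isRelPrime_iff_not_dvd.2 ?_
    rw [X_dvd_X]
    decide
  refine (dvd_gcd h0 h1).trans ?_
  rw [(gcd_mul_left' p _ _).dvd_iff_dvd_left]
  exact (((gcd_isUnit_iff_isRelPrime).2 hrel).dvd_mul_right).1 dvd_rfl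

/-- A binary cubic form `F` of nonzero discriminant has no multiple factors, so it divides `p` if
it divides all products of `p` with partial derivatives of `F`. The proof works in all
characteristics: with `F₁`, `F₂` the partial derivatives, the discriminant is up to sign the
determinant of the forms `F`, `v₂ F₁`, `v₁ F₂`, `v₂ F₂` in the basis of monomials, and its cofactors
write `disc(F) v₁³` as a combination of these forms. The same holds for `v₂³`, by symmetry. -/
lemma dvd_of_dvd_mul_pderiv {t : Cubic k} (ht : t.discr ≠ 0) {p : MvPolynomial (Fin 2) k}
    (h : ∀ i, homogenized t ∣ p * pderiv i (homogenized t)) : homogenized t ∣ p := by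
  have hd0 : pderiv 0 (homogenized t) =
      3 * C t.a * X 0 ^ 2 + 2 * C t.b * X 0 * X 1 + C t.c * X 1 ^ 2 := by
    simp [homogenized, pderiv_X, Derivation.leibniz]
    ring
  have hd1 : pderiv 1 (homogenized t) =
      C t.b * X 0 ^ 2 + 2 * C t.c * X 0 * X 1 + 3 * C t.d * X 1 ^ 2 := by
    simp [homogenized, pderiv_X, Derivation.leibniz]
    ring
  have hunit : ∀ q, homogenized t ∣ p * (C (-t.discr) * q) → homogenized t ∣ p * q := fun q hq => by
    have : p * q = p * (C (-t.discr) * q) * C (-t.discr)⁻¹ := by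
      have e : (C (-t.discr) * C (-t.discr)⁻¹ : MvPolynomial (Fin 2) k) = 1 := by
        rw [← C_mul, mul_inv_cancel₀ (neg_ne_zero.2 ht), C_1]
      linear_combination -p * q * e
    rw [this]
    exact Dvd.dvd.mul_right hq _
  refine dvd_of_dvd_mul_X_pow (n := 3) (hunit _ ?_) (hunit _ ?_)
  · have e : C (-t.discr) * X 0 ^ 3 =
        C (27 * t.a * t.d ^ 2 - 15 * t.b * t.c * t.d + 4 * t.c ^ 3) * homogenized t -
        C (6 * t.b * t.d ^ 2 - 2 * t.c ^ 2 * t.d) * X 1 * pderiv 0 (homogenized t) +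
        C (4 * t.b ^ 2 * t.d - t.b * t.c ^ 2 - 3 * t.a * t.c * t.d) * X 0 *
          pderiv 1 (homogenized t) +
        C (7 * t.b * t.c * t.d - 2 * t.c ^ 3 - 9 * t.a * t.d ^ 2) * X 1 *
          pderiv 1 (homogenized t) := by
      rw [hd0, hd1, Cubic.discr, homogenized]
      simp only [C_neg, C_add, C_sub, C_mul, C_pow, map_ofNat]
      ring
    rw [e, mul_add, mul_add, mul_sub]
    refine dvd_add (dvd_add (dvd_sub ?_ ?_) ?_) ?_
    · exact Dvd.intro_left (p * _) (mul_assoc _ _ _)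
    · rw [mul_left_comm]
      exact (h 0).mul_left _
    · rw [mul_left_comm]
      exact (h 1).mul_left _
    · rw [mul_left_comm]
      exact (h 1).mul_left _
  · have e : C (-t.discr) * X 1 ^ 3 =
        C (27 * t.d * t.a ^ 2 - 15 * t.c * t.b * t.a + 4 * t.b ^ 3) * homogenized t -
        C (6 * t.c * t.a ^ 2 - 2 * t.b ^ 2 * t.a) * X 0 * pderiv 1 (homogenized t) +
        C (4 * t.c ^ 2 * t.a - t.c * t.b ^ 2 - 3 * t.d * t.b * t.a) * X 1 *
          pderiv 0 (homogenized t) +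
        C (7 * t.c * t.b * t.a - 2 * t.b ^ 3 - 9 * t.d * t.a ^ 2) * X 0 *
          pderiv 0 (homogenized t) := by
      rw [hd0, hd1, Cubic.discr, homogenized]
      simp only [C_neg, C_add, C_sub, C_mul, C_pow, map_ofNat]
      ring
    rw [e, mul_add, mul_add, mul_sub]
    refine dvd_add (dvd_add (dvd_sub ?_ ?_) ?_) ?_
    · exact Dvd.intro_left (p * _) (mul_assoc _ _ _)
    · rw [mul_left_comm]
      exact (h 1).mul_left _
    · rw [mul_left_comm]
      exact (h 0).mul_left _
    · rw [mul_left_comm]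
      exact (h 0).mul_left _

lemma exists_eq_C_mul_of_dvd {F p : MvPolynomial (Fin 2) k} {n : ℕ} (hF : F.IsHomogeneous n)
    (hp : p.IsHomogeneous n) (hp0 : p ≠ 0) (h : F ∣ p) : ∃ r : k, r ≠ 0 ∧ p = C r * F := by
  obtain ⟨q, rfl⟩ := h
  have hF0 : F ≠ 0 := left_ne_zero_of_mul hp0
  have hq0 : q ≠ 0 := right_ne_zero_of_mul hp0
  have h1 := totalDegree_mul_of_isDomain hF0 hq0
  rw [hp.totalDegree hp0, hF.totalDegree hF0] at h1
  have hq := totalDegree_eq_zero_iff_eq_C.1 (show q.totalDegree = 0 by omega)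
  refine ⟨coeff 0 q, fun h0 => hq0 ?_, ?_⟩
  · rw [hq, h0, C_0]
  · rw [← hq, mul_comm]

end Divisibility

/-! ### The Pfaffian under change of scalars and congruence -/

section QuaternionPfaffian

open Quaternion

section Map

variable {R S : Type*} [CommRing R] [CommRing S] {a b c : R} {a' b' c' : S}

/-- Apply a ring homomorphism to the coordinates of a quaternion. -/
def quaternionMap (φ : R →+* S) (ha : φ a = a') (hb : φ b = b') (hc : φ c = c') :
    ℍ[R,a,b,c] →+* ℍ[S,a',b',c'] where
  toFun q := ⟨φ q.re, φ q.imI, φ q.imJ, φ q.imK⟩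
  map_one' := by ext <;> simp
  map_zero' := by ext <;> simp
  map_add' p q := by ext <;> simp
  map_mul' p q := by ext <;> simp [ha, hb, hc]

variable (φ : R →+* S) (ha : φ a = a') (hb : φ b = b') (hc : φ c = c')

lemma quaternionMap_star (q : ℍ[R,a,b,c]) :
    quaternionMap φ ha hb hc (star q) = star (quaternionMap φ ha hb hc q) := by
  ext <;> simp [quaternionMap, hb]

lemma pfaff3_map (m : Matrix (Fin 3) (Fin 3) ℍ[R,a,b,c]) :
    pfaff3 (m.map (quaternionMap φ ha hb hc)) = φ (pfaff3 m) := by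
  have hre : ∀ q, (quaternionMap φ ha hb hc q).re = φ q.re := fun _ => rfl
  simp only [pfaff3, qNorm, qTrace, Matrix.map_apply, ← quaternionMap_star, ← map_mul, ← map_add,
    ← map_sub, hre]

end Map

namespace HermitianData

variable {R : Type*} [CommRing R] {a b c : R}

section Congruence

variable {h h' : HermitianData R a b c} {g g' : Matrix (Fin 3) (Fin 3) ℍ[R,a,b,c]}

/-- Under a congruence `h ↦ g h g*` the adjoint transforms by `g*⁻¹`, up to the ratio of the
Pfaffians. -/
lemma pf_smul_congruence_adj (hg : g' * g = 1)
    (hh : h'.toMatrix = g * h.toMatrix * g.conjTranspose) :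
    h.pf • (g.conjTranspose * h'.adj.toMatrix * g) = h'.pf • h.adj.toMatrix := by
  have e : h.toMatrix * (g.conjTranspose * h'.adj.toMatrix * g) =
      h'.pf • (1 : Matrix (Fin 3) (Fin 3) ℍ[R,a,b,c]) := by
    calc h.toMatrix * (g.conjTranspose * h'.adj.toMatrix * g)
        = g' * g * (h.toMatrix * (g.conjTranspose * h'.adj.toMatrix * g)) := by
          rw [hg, Matrix.one_mul]
      _ = g' * (g * h.toMatrix * g.conjTranspose * h'.adj.toMatrix) * g := by
          simp only [Matrix.mul_assoc]
      _ = h'.pf • (1 : Matrix (Fin 3) (Fin 3) ℍ[R,a,b,c]) := by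
          rw [← hh, toMatrix_mul_toMatrix_adj, Matrix.mul_smul, Matrix.mul_one, Matrix.smul_mul, hg]
  calc h.pf • (g.conjTranspose * h'.adj.toMatrix * g)
      = h.adj.toMatrix * h.toMatrix * (g.conjTranspose * h'.adj.toMatrix * g) := by
        rw [toMatrix_adj_mul_toMatrix, Matrix.smul_mul, Matrix.one_mul]
    _ = h'.pf • h.adj.toMatrix := by
        rw [Matrix.mul_assoc, e, Matrix.mul_smul, Matrix.mul_one]

lemma pf_mul_traceForm_congruence (hg : g' * g = 1)
    (hh : h'.toMatrix = g * h.toMatrix * g.conjTranspose) {A : Type*} [CommRing A] [Algebra A R]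
    (D : Derivation A R R) (ha : D a = 0) (hb : D b = 0) (hc : D c = 0) :
    h.pf * traceForm (g.conjTranspose * h'.adj.toMatrix * g) (h.derive D) = h'.pf * D h.pf := by
  rw [← traceForm_smul, pf_smul_congruence_adj hg hh, traceForm_smul, derivation_pf D ha hb hc]

lemma _root_.CubicOrbits.quaternionMatrix_eq_zero_of_smul [IsDomain R] {r : R} (hr : r ≠ 0)
    {m : Matrix (Fin 3) (Fin 3) ℍ[R,a,b,c]} (h : r • m = 0) : m = 0 := by
  ext1 i j
  have e : r • m i j = 0 := congrFun (congrFun h i) j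
  have e1 := congrArg QuaternionAlgebra.re e
  have e2 := congrArg QuaternionAlgebra.imI e
  have e3 := congrArg QuaternionAlgebra.imJ e
  have e4 := congrArg QuaternionAlgebra.imK e
  exact QuaternionAlgebra.ext ((mul_eq_zero.1 e1).resolve_left hr)
    ((mul_eq_zero.1 e2).resolve_left hr) ((mul_eq_zero.1 e3).resolve_left hr)
    ((mul_eq_zero.1 e4).resolve_left hr)

lemma pf_congruence_ne_zero [IsDomain R] (hg : g' * g = 1) (hg' : g * g' = 1)
    (hh : h'.toMatrix = g * h.toMatrix * g.conjTranspose) (hpf : h.pf ≠ 0) : h'.pf ≠ 0 := by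
  intro h0
  have hgc : g.conjTranspose * g'.conjTranspose = 1 := by
    rw [← Matrix.conjTranspose_mul, hg, Matrix.conjTranspose_one]
  have hgc' : g'.conjTranspose * g.conjTranspose = 1 := by
    rw [← Matrix.conjTranspose_mul, hg', Matrix.conjTranspose_one]
  have hS : g.conjTranspose * h'.adj.toMatrix * g = 0 := quaternionMatrix_eq_zero_of_smul hpf <| by
    rw [pf_smul_congruence_adj hg hh, h0, zero_smul]
  have hadj : h'.adj.toMatrix = 0 := by
    calc h'.adj.toMatrix
        = g'.conjTranspose * g.conjTranspose * h'.adj.toMatrix * (g * g') := by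
          rw [hgc', hg', Matrix.one_mul, Matrix.mul_one]
      _ = g'.conjTranspose * (g.conjTranspose * h'.adj.toMatrix * g) * g' := by
          simp only [Matrix.mul_assoc]
      _ = 0 := by rw [hS, Matrix.mul_zero, Matrix.zero_mul]
  have hX' : h'.toMatrix = 0 := toMatrix_eq_zero_of_adj_eq_zero hadj fun m hm => by
    have hmg : m * g = 0 := quaternionMatrix_eq_zero_of_smul hpf <| by
      calc h.pf • (m * g) = m * g * (h.toMatrix * h.adj.toMatrix) := by
            rw [toMatrix_mul_toMatrix_adj, Matrix.mul_smul, Matrix.mul_one]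
        _ = m * (g * h.toMatrix * g.conjTranspose) * g'.conjTranspose * h.adj.toMatrix := by
            simp only [Matrix.mul_assoc]
            rw [← Matrix.mul_assoc g.conjTranspose, hgc, Matrix.one_mul]
        _ = 0 := by rw [← hh, hm, Matrix.zero_mul, Matrix.zero_mul]
    rw [← Matrix.mul_one m, ← hg', ← Matrix.mul_assoc, hmg, Matrix.zero_mul]
  have hX : h.toMatrix = 0 := by
    calc h.toMatrix = g' * g * h.toMatrix * (g.conjTranspose * g'.conjTranspose) := by
          rw [hgc, hg, Matrix.one_mul, Matrix.mul_one]
      _ = g' * (g * h.toMatrix * g.conjTranspose) * g'.conjTranspose := by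
          simp only [Matrix.mul_assoc]
      _ = 0 := by rw [← hh, hX', Matrix.mul_zero, Matrix.zero_mul]
  refine hpf ?_
  rw [← pfaff3_toMatrix, hX]
  simp [pfaff3, qNorm, qTrace]

end Congruence

end HermitianData

variable {k : Type u} [Field k] {a b c : k}

/-- The data of the matrix `h₁ v₁ + h₂ v₂` of linear forms. -/
def HermitianData.pencil (h₁ h₂ : HermitianData k a b c) :
    HermitianData (MvPolynomial (Fin 2) k) (C a) (C b) (C c) where
  r₁ := C h₁.r₁ * X 0 + C h₂.r₁ * X 1
  r₂ := C h₁.r₂ * X 0 + C h₂.r₂ * X 1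
  r₃ := C h₁.r₃ * X 0 + C h₂.r₃ * X 1
  x := linearQuaternion h₁.x h₂.x
  y := linearQuaternion h₁.y h₂.y
  z := linearQuaternion h₁.z h₂.z

lemma linearMatrixC_toMatrix (h₁ h₂ : HermitianData k a b c) :
    linearMatrixC h₁.toMatrix h₂.toMatrix = (h₁.pencil h₂).toMatrix := by
  ext1 i j
  fin_cases i <;> fin_cases j <;> refine QuaternionAlgebra.ext ?_ ?_ ?_ ?_ <;>
  simp [linearMatrixC, HermitianData.toMatrix, HermitianData.pencil, linearQuaternion,
    QuaternionAlgebra.algebraMap_eq] <;> ring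

lemma exists_toMatrix_eq {y : Matrix (Fin 3) (Fin 3) ℍ[k,a,b,c]} (hy : y ∈ YC a b c) :
    ∃ h : HermitianData k a b c, h.toMatrix = y := by
  obtain ⟨hy, hd⟩ := hy
  have hs : ∀ i j, star (y i j) = y j i := fun i j => congrFun (congrFun hy j) i
  obtain ⟨r₁, h₁⟩ := hd 0
  obtain ⟨r₂, h₂⟩ := hd 1
  obtain ⟨r₃, h₃⟩ := hd 2
  refine ⟨⟨r₁, r₂, r₃, y 1 2, y 2 0, y 0 1⟩, ?_⟩
  ext1 i j
  fin_cases i <;> fin_cases j <;> simp [HermitianData.toMatrix, hs, h₁, h₂, h₃]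

lemma linearMatrixC_eq (x₁ x₂ : Matrix (Fin 3) (Fin 3) ℍ[k,a,b,c]) :
    linearMatrixC x₁ x₂ = (X 0 : MvPolynomial (Fin 2) k) • x₁.map (quaternionMap C rfl rfl rfl) +
      (X 1 : MvPolynomial (Fin 2) k) • x₂.map (quaternionMap C rfl rfl rfl) := by
  ext1 i j
  ext <;> simp [linearMatrixC, linearQuaternion, quaternionMap, mul_comm]

lemma linearMatrixC_mul (g h x₁ x₂ : Matrix (Fin 3) (Fin 3) ℍ[k,a,b,c]) :
    linearMatrixC (g * x₁ * h) (g * x₂ * h) =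
      g.map (quaternionMap C rfl rfl rfl) * linearMatrixC x₁ x₂ *
        h.map (quaternionMap C rfl rfl rfl) := by
  simp only [linearMatrixC_eq, Matrix.map_mul, Matrix.mul_add, Matrix.add_mul, Matrix.mul_smul,
    Matrix.smul_mul]

lemma pfaff3_linearSubst (g : Matrix (Fin 2) (Fin 2) k)
    (x₁ x₂ : Matrix (Fin 3) (Fin 3) ℍ[k,a,b,c]) :
    pfaff3 (linearMatrixC (g 0 0 • x₁ + g 0 1 • x₂) (g 1 0 • x₁ + g 1 1 • x₂)) =
      linearSubst g (pfaff3 (linearMatrixC x₁ x₂)) := by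
  have hC : ∀ r : k, (linearSubst g).toRingHom (C r) = C r := linearSubst_C g
  refine Eq.trans ?_ (pfaff3_map (linearSubst g).toRingHom (hC a) (hC b) (hC c) _)
  congr 1
  ext1 i j
  refine QuaternionAlgebra.ext ?_ ?_ ?_ ?_ <;>
  simp [linearMatrixC, linearQuaternion, quaternionMap, linearSubst_X] <;> ring

lemma eval_pfaff3_linearMatrixC (x₁ x₂ : Matrix (Fin 3) (Fin 3) ℍ[k,a,b,c]) :
    eval ![1, 0] (pfaff3 (linearMatrixC x₁ x₂)) = pfaff3 x₁ := by
  rw [← pfaff3_map (a' := a) (b' := b) (c' := c) (eval ![1, 0]) (eval_C a) (eval_C b) (eval_C c)]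
  congr 1
  ext1 i j
  ext <;> simp [linearMatrixC, linearQuaternion, quaternionMap]

lemma eval_pderiv_pf_pencil (h₁ h₂ : HermitianData k a b c) :
    eval ![1, 0] (pderiv 1 (h₁.pencil h₂).pf) =
      HermitianData.traceForm h₁.adj.toMatrix h₂ := by
  rw [HermitianData.derivation_pf _ pderiv_C pderiv_C pderiv_C]
  simp only [HermitianData.traceForm, HermitianData.derive, HermitianData.adj,
    HermitianData.toMatrix, HermitianData.pencil, linearQuaternion, quaternionDerive, qNorm, qTrace]
  simp [pderiv_X, QuaternionAlgebra.algebraMap_eq]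
  ring

/-- Congruence by `g` changes the Pfaffian form of a pair by a nonzero constant. Write `F` and `F'`
for the two forms. As the adjoint gives the differential of the Pfaffian, `F` divides the products
of `F'` with the partial derivatives of `F`, so it divides `F'`, which is of the same degree. -/
lemma exists_pfaff3_congruence {x₁ x₂ : Matrix (Fin 3) (Fin 3) ℍ[k,a,b,c]} (h₁ : x₁ ∈ YC a b c)
    (h₂ : x₂ ∈ YC a b c) (g : GL3 ℍ[k,a,b,c])
    (hdisc : disc (⟨_, isHomogeneous_pfaff3 x₁ x₂⟩ : BinaryCubic k) ≠ 0) :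
    ∃ r : k, r ≠ 0 ∧ pfaff3 (linearMatrixC (g.1 * x₁ * g.1.conjTranspose)
      (g.1 * x₂ * g.1.conjTranspose)) = C r * pfaff3 (linearMatrixC x₁ x₂) := by
  obtain ⟨d₁, e₁⟩ := exists_toMatrix_eq h₁
  obtain ⟨d₂, e₂⟩ := exists_toMatrix_eq h₂
  obtain ⟨d₁', e₁'⟩ := exists_toMatrix_eq (g • (⟨x₁, h₁⟩ : YC a b c)).2
  obtain ⟨d₂', e₂'⟩ := exists_toMatrix_eq (g • (⟨x₂, h₂⟩ : YC a b c)).2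
  replace e₁' : d₁'.toMatrix = g.1 * x₁ * g.1.conjTranspose := e₁'
  replace e₂' : d₂'.toMatrix = g.1 * x₂ * g.1.conjTranspose := e₂'
  let q : ℍ[k,a,b,c] →+* ℍ[MvPolynomial (Fin 2) k,(C a),(C b),(C c)] := quaternionMap C rfl rfl rfl
  have hF : pfaff3 (linearMatrixC x₁ x₂) = (d₁.pencil d₂).pf := by
    rw [← e₁, ← e₂, linearMatrixC_toMatrix, HermitianData.pfaff3_toMatrix]
  have hF' : pfaff3 (linearMatrixC (g.1 * x₁ * g.1.conjTranspose)
      (g.1 * x₂ * g.1.conjTranspose)) = (d₁'.pencil d₂').pf := by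
    rw [← e₁', ← e₂', linearMatrixC_toMatrix, HermitianData.pfaff3_toMatrix]
  have hg : g⁻¹.1.map q * g.1.map q = 1 := by
    rw [← Matrix.map_mul, ← Units.val_mul, inv_mul_cancel, Units.val_one,
      Matrix.map_one _ (map_zero q) (map_one q)]
  have hg' : g.1.map q * g⁻¹.1.map q = 1 := by
    rw [← Matrix.map_mul, ← Units.val_mul, mul_inv_cancel, Units.val_one,
      Matrix.map_one _ (map_zero q) (map_one q)]
  have hh : (d₁'.pencil d₂').toMatrix =
      g.1.map q * (d₁.pencil d₂).toMatrix * (g.1.map q).conjTranspose := by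
    rw [← linearMatrixC_toMatrix, ← linearMatrixC_toMatrix, e₁, e₂, e₁', e₂', linearMatrixC_mul]
    congr 1
    ext1 i j
    exact quaternionMap_star C rfl rfl rfl _
  set f : BinaryCubic k := ⟨_, isHomogeneous_pfaff3 x₁ x₂⟩
  have hf : homogenized (coeffs f) = (d₁.pencil d₂).pf := (homogenized_coeffs f).trans hF
  have hne : (d₁.pencil d₂).pf ≠ 0 := fun h0 => hdisc <| by
    have : f = 0 := Subtype.ext (hF.trans h0)
    simp [this, disc, Cubic.discr]
  rw [disc_eq_discr] at hdisc
  have hdvd : (d₁.pencil d₂).pf ∣ (d₁'.pencil d₂').pf := by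
    rw [← hf]
    refine dvd_of_dvd_mul_pderiv hdisc fun i => ?_
    rw [hf]
    exact ⟨_, (HermitianData.pf_mul_traceForm_congruence hg hh (pderiv i) pderiv_C pderiv_C
      pderiv_C).symm⟩
  rw [hF, hF']
  refine exists_eq_C_mul_of_dvd (n := 3) ?_ ?_
    (HermitianData.pf_congruence_ne_zero hg hg' hh hne) hdvd
  · rw [← hF]
    exact isHomogeneous_pfaff3 _ _
  · rw [← hF']
    exact isHomogeneous_pfaff3 _ _

end QuaternionPfaffian

/-! ### Pairs of Hermitian forms over a quaternion algebra -/

section QuaternionHermitian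

open Quaternion

variable {k : Type u} [Field k] {a b c : k}

lemma eq_zero_of_forall_qTrace_mul_eq_zero (hc : c ≠ 0) (hd : b ^ 2 + 4 * a ≠ 0) {q : ℍ[k,a,b,c]}
    (h : ∀ p, qTrace (p * q) = 0) : q = 0 := by
  have h1 := h ⟨1, 0, 0, 0⟩
  have h2 := h ⟨0, 1, 0, 0⟩
  have h3 := h ⟨0, 0, 1, 0⟩
  have h4 := h ⟨0, 0, 0, 1⟩
  simp only [qTrace, QuaternionAlgebra.re_add, QuaternionAlgebra.re_star, QuaternionAlgebra.re_mul,
    QuaternionAlgebra.imI_mul] at h1 h2 h3 h4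
  have hcd := mul_ne_zero hc hd
  refine QuaternionAlgebra.ext ((mul_eq_zero.1 ?_).resolve_left hd)
    ((mul_eq_zero.1 ?_).resolve_left hd) ((mul_eq_zero.1 ?_).resolve_left hcd)
    ((mul_eq_zero.1 ?_).resolve_left hcd)
  · linear_combination (b ^ 2 + 2 * a) * h1 - b * h2
  · linear_combination 2 * h2 - b * h1
  · linear_combination 2 * a * h3 + b * h4
  · linear_combination b * h3 - 2 * h4

lemma exists_unit_matrix_row_zero_eq {s : k} (hs : s ≠ 0) (p q : ℍ[k,a,b,c]) :
    ∃ g : GL3 ℍ[k,a,b,c], g.1 0 = ![algebraMap k _ s, p, q] := by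
  have e : algebraMap k ℍ[k,a,b,c] s * algebraMap k ℍ[k,a,b,c] s⁻¹ = 1 := by
    rw [← map_mul, mul_inv_cancel₀ hs, map_one]
  have e' : algebraMap k ℍ[k,a,b,c] s⁻¹ * algebraMap k ℍ[k,a,b,c] s = 1 := by
    rw [← map_mul, inv_mul_cancel₀ hs, map_one]
  refine ⟨⟨!![algebraMap k _ s, p, q; 0, 1, 0; 0, 0, 1],
    !![algebraMap k _ s⁻¹, -(algebraMap k _ s⁻¹ * p), -(algebraMap k _ s⁻¹ * q); 0, 1, 0; 0, 0, 1],
    ?_, ?_⟩, rfl⟩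
  · rw [Matrix.mul_fin_three, Matrix.one_fin_three]
    simp [-QuaternionAlgebra.coe_algebraMap, e, ← mul_assoc]
  · rw [Matrix.mul_fin_three, Matrix.one_fin_three]
    simp [-QuaternionAlgebra.coe_algebraMap, e']

namespace HermitianData

/-- The value of a Hermitian form at the row vector `(1, p, q)`. -/
def value (h : HermitianData k a b c) (p q : ℍ[k,a,b,c]) : k :=
  h.r₁ + qNorm p * h.r₂ + qNorm q * h.r₃ + qTrace (p * star h.z) + qTrace (q * h.y) +
    qTrace (p * (h.x * star q))

lemma congruence_toMatrix_zero_zero (h : HermitianData k a b c) {p q : ℍ[k,a,b,c]}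
    {g : Matrix (Fin 3) (Fin 3) ℍ[k,a,b,c]} (hg : g 0 = ![1, p, q]) :
    (g * h.toMatrix * g.conjTranspose) 0 0 = algebraMap k _ (h.value p q) := by
  have h0 : g 0 0 = 1 := congrFun hg 0
  have h1 : g 0 1 = p := congrFun hg 1
  have h2 : g 0 2 = q := congrFun hg 2
  obtain ⟨r₁, r₂, r₃, ⟨x0, x1, x2, x3⟩, ⟨y0, y1, y2, y3⟩, ⟨z0, z1, z2, z3⟩⟩ := h
  obtain ⟨p0, p1, p2, p3⟩ := p
  obtain ⟨q0, q1, q2, q3⟩ := q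
  simp only [Matrix.mul_apply, Matrix.conjTranspose_apply, Fin.sum_univ_three, h0, h1, h2, toMatrix,
    value, qNorm, qTrace]
  ext <;> simp [QuaternionAlgebra.algebraMap_eq] <;> ring

/-- A nonzero Hermitian form over a quaternion algebra takes a nonzero value at some vector
`(1, p, q)`. -/
lemma exists_value_ne_zero (hc : c ≠ 0) (hd : b ^ 2 + 4 * a ≠ 0) {h : HermitianData k a b c}
    (hh : h.toMatrix ≠ 0) : ∃ p q, h.value p q ≠ 0 := by
  by_contra! hv
  -- A form `p ↦ T(p u) + N(p) r` that vanishes identically is zero, by polarization.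
  have key : ∀ (u : ℍ[k,a,b,c]) (r : k), (∀ p, qTrace (p * u) + qNorm p * r = 0) →
      r = 0 ∧ u = 0 := by
    intro u r hur
    have hr : r = 0 := by
      by_contra hr
      have h1 : (1 : ℍ[k,a,b,c]) = 0 := eq_zero_of_forall_qTrace_mul_eq_zero hc hd fun p => by
        have e1 := hur (p + 1)
        have e2 := hur p
        have e3 := hur 1
        refine (mul_eq_zero.1 ?_).resolve_right hr
        simp [qTrace, qNorm, -mul_eq_zero] at e1 e2 e3 ⊢
        linear_combination e1 - e2 - e3
      simpa using congrArg QuaternionAlgebra.re h1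
    refine ⟨hr, eq_zero_of_forall_qTrace_mul_eq_zero hc hd fun p => ?_⟩
    simpa [hr] using hur p
  have hN : qNorm (0 : ℍ[k,a,b,c]) = 0 := by simp [qNorm]
  have hT : qTrace (0 : ℍ[k,a,b,c]) = 0 := by simp [qTrace]
  have h1 : h.r₁ = 0 := by simpa [value, hN, hT] using hv 0 0
  obtain ⟨h2, hz⟩ := key (star h.z) h.r₂ fun p => by
    have := hv p 0
    simp only [value, h1, hN, star_zero, mul_zero, zero_mul, hT] at this
    linear_combination this
  obtain ⟨h3, hy⟩ := key h.y h.r₃ fun q => by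
    have := hv 0 q
    simp only [value, h1, hN, zero_mul, hT] at this
    linear_combination this
  have hx : h.x = 0 := eq_zero_of_forall_qTrace_mul_eq_zero hc hd fun p => by
    have := hv p 1
    simpa only [value, h1, h2, h3, hy, hz, star_one, mul_one, mul_zero, hT, zero_add,
      add_zero] using this
  exact hh (toMatrix_eq_zero_iff.2 ⟨⟨h1, h2, h3⟩, hx, hy, star_eq_zero.1 hz⟩)

/-- A Hermitian matrix whose Pfaffian vanishes to first order only has a left kernel vector that
extends to an invertible matrix: a row of the adjoint, after a change of basis that makes the first
entry of the adjoint invertible. -/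
lemma exists_mul_row_eq_zero (hc : c ≠ 0) (hd : b ^ 2 + 4 * a ≠ 0) {h : HermitianData k a b c}
    (hpf : h.pf = 0) (hadj : h.adj.toMatrix ≠ 0) :
    ∃ g : GL3 ℍ[k,a,b,c], ∀ j, (g.1 * h.toMatrix) 0 j = 0 := by
  obtain ⟨p, q, hpq⟩ := exists_value_ne_zero hc hd hadj
  obtain ⟨g, hg⟩ := exists_unit_matrix_row_zero_eq one_ne_zero p q
  rw [map_one] at hg
  have e := congruence_toMatrix_zero_zero h.adj hg
  set M := g.1 * h.adj.toMatrix * g.1.conjTranspose with hM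
  obtain ⟨t, ht⟩ := exists_unit_matrix_row_zero_eq hpq (M 0 1) (M 0 2)
  have hrow : t.1 0 = M 0 := by
    rw [ht, ← e]
    exact funext fun i => by fin_cases i <;> rfl
  have hinv : g.1.conjTranspose * g⁻¹.1.conjTranspose = 1 := by
    rw [← Matrix.conjTranspose_mul, ← Units.val_mul, inv_mul_cancel, Units.val_one,
      Matrix.conjTranspose_one]
  have hinv' : g⁻¹.1.conjTranspose * g.1.conjTranspose = 1 := by
    rw [← Matrix.conjTranspose_mul, ← Units.val_mul, mul_inv_cancel, Units.val_one,
      Matrix.conjTranspose_one]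
  refine ⟨t * ⟨g⁻¹.1.conjTranspose, g.1.conjTranspose, hinv', hinv⟩, fun j => ?_⟩
  have h0 : M * g⁻¹.1.conjTranspose * h.toMatrix = 0 := by
    rw [hM, Matrix.mul_assoc _ g.1.conjTranspose, hinv, Matrix.mul_one, Matrix.mul_assoc,
      toMatrix_adj_mul_toMatrix, hpf, zero_smul, Matrix.mul_zero]
  have h1 : (M * g⁻¹.1.conjTranspose * h.toMatrix) 0 j = 0 := congrFun (congrFun h0 0) j
  rw [Matrix.mul_assoc, Matrix.mul_apply] at h1
  rw [Units.val_mul, Matrix.mul_assoc, Matrix.mul_apply]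
  simpa only [hrow] using h1

end HermitianData

lemma formC_eq {x : Pair (YC a b c)} {m₁ m₂ : Matrix (Fin 3) (Fin 3) ℍ[k,a,b,c]}
    (h₁ : m₁ = x.1.1) (h₂ : m₂ = x.2.1) : (formC a b c x).1 = pfaff3 (linearMatrixC m₁ m₂) := by
  subst h₁ h₂
  rfl

lemma exists_coeffs_formC_eq (x : Pair (YC a b c)) : ∃ h₁ h₂ : HermitianData k a b c,
    h₁.toMatrix = x.1.1 ∧ (coeffs (formC a b c x)).a = h₁.pf ∧
      (coeffs (formC a b c x)).b = HermitianData.traceForm h₁.adj.toMatrix h₂ := by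
  obtain ⟨h₁, e₁⟩ := exists_toMatrix_eq x.1.2
  obtain ⟨h₂, e₂⟩ := exists_toMatrix_eq x.2.2
  have hF : (formC a b c x).1 = (h₁.pencil h₂).pf := by
    rw [formC_eq e₁ e₂, linearMatrixC_toMatrix, HermitianData.pfaff3_toMatrix]
  refine ⟨h₁, h₂, e₁, ?_, ?_⟩
  · rw [coeffs_a_eq_eval, formC_eq e₁ e₂, eval_pfaff3_linearMatrixC, HermitianData.pfaff3_toMatrix]
  · rw [coeffs_b_eq_eval, hF, eval_pderiv_pf_pencil]

variable (a b c)

theorem contractedProduct_quaternionHermitian (hc : c ≠ 0) (hd : b ^ 2 + 4 * a ≠ 0) :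
    (∀ p ∈ PC a b c, ∀ w ∈ WC a b c, p • w ∈ WC a b c) ∧
      EqContractedProduct (V2C a b c) (PC a b c) (W2C a b c) ∧
      (∀ x ∈ V2C a b c, ∃ g : GC a b c, g • x ∈ WC a b c) ∧
      (∀ w ∈ W2C a b c, ∀ w' ∈ W2C a b c,
        (∃ g : GC a b c, g • w = w') → ∃ p ∈ PC a b c, p • w = w') := by
  have hsmul : ∀ (g : GL3 ℍ[k,a,b,c]) (y : YC a b c), (g • y).1 = g.1 * y.1 * g.1.conjTranspose :=
    fun _ _ => rfl
  have hherm : ∀ (y : YC a b c) (i j), star (y.1 i j) = y.1 j i := fun y i j =>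
    congrFun (congrFun y.2.1 j) i
  have hZC : ∀ y : YC a b c, (∀ i, y.1 0 i = 0) → y ∈ ZC a b c := fun y hy i =>
    ⟨hy i, by rw [← hherm, hy, star_zero]⟩
  refine contractedProduct_of_covariant (formC a b c) (P12 ℍ[k,a,b,c]) (ZC a b c) ?_ ?_ ?_ ?_ ?_ ?_
  · intro g x
    exact (formC_eq (congrArg Subtype.val (one_prod_smul g x).1.symm)
      (congrArg Subtype.val (one_prod_smul g x).2.symm)).trans (pfaff3_linearSubst g.1 x.1.1 x.2.1)
  · intro g x hx
    obtain ⟨r, hr, e⟩ := exists_pfaff3_congruence x.1.2 x.2.2 g hx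
    exact ⟨r, hr, (formC_eq (congrArg Subtype.val (prod_one_smul g x).1.symm)
      (congrArg Subtype.val (prod_one_smul g x).2.symm)).trans e⟩
  · rintro g ⟨hg1, hg2⟩ z hz
    refine hZC _ fun i => ?_
    have hz' : ∀ i, z.1 0 i = 0 ∧ z.1 i 0 = 0 := hz
    rw [hsmul]
    simp [Matrix.mul_apply, Fin.sum_univ_three, hg1, hg2, (hz' _).1]
  · intro x hx
    have hx' : ∀ i, x.1.1 0 i = 0 ∧ x.1.1 i 0 = 0 := hx
    rw [coeffs_a_eq_eval, formC, eval_pfaff3_linearMatrixC]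
    simp [pfaff3, qNorm, qTrace, (hx' _).1, (hx' _).2]
  · intro x ha hb
    obtain ⟨h₁, h₂, e₁, ea, eb⟩ := exists_coeffs_formC_eq x
    obtain ⟨g, hg⟩ := HermitianData.exists_mul_row_eq_zero hc hd (ea.symm.trans ha)
      fun h0 => hb <| by
      rw [eb, h0]
      simp [HermitianData.traceForm, qTrace]
    refine ⟨g, hZC _ fun i => ?_⟩
    rw [hsmul, Matrix.mul_apply, ← e₁]
    exact Finset.sum_eq_zero fun l _ => by rw [hg, zero_mul]
  · intro x hb hx g hgx
    obtain ⟨h₁, h₂, e₁, -, eb⟩ := exists_coeffs_formC_eq x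
    have hx' : ∀ i, h₁.toMatrix 0 i = 0 := fun i => by
      rw [e₁]
      exact (hx i).1
    have hinj := QuaternionAlgebra.algebraMap_injective (R := k) (c₁ := a) (c₂ := b) (c₃ := c)
    have hr : h₁.r₁ = 0 := hinj ((hx' 0).trans (map_zero _).symm)
    have hz : h₁.z = 0 := hx' 1
    have hy : h₁.y = 0 := star_eq_zero.1 (hx' 2)
    -- The complementary `2 × 2` minor is a nonzero scalar.
    have hδ : h₁.r₂ * h₁.r₃ - qNorm h₁.x ≠ 0 := fun h0 => hb <| by
      have hN : qNorm (0 : ℍ[k,a,b,c]) = 0 := by simp [qNorm]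
      rw [eb]
      simp [HermitianData.traceForm, HermitianData.adj, HermitianData.toMatrix, h0, hr, hz, hy,
        hN, qTrace]
    have hunit : ∀ {q : ℍ[k,a,b,c]}, (h₁.r₂ * h₁.r₃ - qNorm h₁.x) • q = 0 → q = 0 :=
      fun {q} hq => by
      rw [← inv_smul_smul₀ hδ q, hq, smul_zero]
    have hrow : ∀ j, (g.1 * h₁.toMatrix) 0 j = 0 := fun j => by
      have hinv : g.1.conjTranspose * g⁻¹.1.conjTranspose = 1 := by
        rw [← Matrix.conjTranspose_mul, ← Units.val_mul, inv_mul_cancel, Units.val_one,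
          Matrix.conjTranspose_one]
      rw [← Matrix.mul_one (g.1 * h₁.toMatrix), ← hinv, ← Matrix.mul_assoc, Matrix.mul_apply]
      refine Finset.sum_eq_zero fun l _ => ?_
      rw [e₁, ← hsmul, (hgx l).1, zero_mul]
    have h1 := hrow 1
    have h2 := hrow 2
    simp only [Matrix.mul_apply, Fin.sum_univ_three, hx', mul_zero, zero_add] at h1 h2
    have e1 : g.1 0 1 * algebraMap k _ h₁.r₂ + g.1 0 2 * star h₁.x = 0 := h1
    have e2 : g.1 0 1 * h₁.x + g.1 0 2 * algebraMap k _ h₁.r₃ = 0 := h2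
    have hN : h₁.x * star h₁.x = algebraMap k _ (qNorm h₁.x) := QuaternionAlgebra.mul_star_eq_coe _
    have hN' : star h₁.x * h₁.x = algebraMap k _ (qNorm h₁.x) := by
      rw [← hN]
      exact star_comm_self' _
    refine ⟨hunit ?_, hunit ?_⟩
    · calc (h₁.r₂ * h₁.r₃ - qNorm h₁.x) • g.1 0 1
          = (g.1 0 1 * algebraMap k _ h₁.r₂ + g.1 0 2 * star h₁.x) * algebraMap k _ h₁.r₃ -
            (g.1 0 1 * h₁.x + g.1 0 2 * algebraMap k _ h₁.r₃) * star h₁.x := by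
            rw [add_mul, add_mul, mul_assoc, mul_assoc, mul_assoc, mul_assoc, hN,
              Algebra.commutes h₁.r₃ (star h₁.x), add_sub_add_right_eq_sub, ← mul_sub, ← map_mul,
              ← map_sub, ← Algebra.commutes, ← Algebra.smul_def]
        _ = 0 := by rw [e1, e2, zero_mul, zero_mul, sub_zero]
    · calc (h₁.r₂ * h₁.r₃ - qNorm h₁.x) • g.1 0 2
          = (g.1 0 1 * h₁.x + g.1 0 2 * algebraMap k _ h₁.r₃) * algebraMap k _ h₁.r₂ -
            (g.1 0 1 * algebraMap k _ h₁.r₂ + g.1 0 2 * star h₁.x) * h₁.x := by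
            rw [add_mul, add_mul, mul_assoc, mul_assoc, mul_assoc, mul_assoc, hN',
              Algebra.commutes h₁.r₂ h₁.x, add_sub_add_left_eq_sub, ← mul_sub, ← map_mul,
              ← map_sub, ← Algebra.commutes, ← Algebra.smul_def, mul_comm h₁.r₃]
        _ = 0 := by rw [e1, e2, zero_mul, zero_mul, sub_zero]

end QuaternionHermitian

end CubicOrbits

end

open CubicOrbits Quaternion in
theorem mainTheorem7 {k : Type*} [Field k] :
    -- Case (a)
    ((∀ p ∈ PA k, ∀ w ∈ WA k, p • w ∈ WA k) ∧
      EqContractedProduct (V2A k) (PA k) (W2A k) ∧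
      (∀ x ∈ V2A k, ∃ g : GA k, g • x ∈ WA k) ∧
      (∀ w ∈ W2A k, ∀ w' ∈ W2A k, (∃ g : GA k, g • w = w') → ∃ p ∈ PA k, p • w = w')) ∧
    -- Case (b)
    (∀ (F : Type*) [Field F] [Algebra k F] (σ : F ≃ₐ[k] F) [IsQuadraticConj σ],
      (∀ p ∈ PB k F, ∀ w ∈ WB σ, p • w ∈ WB σ) ∧
      EqContractedProduct (V2B σ) (PB k F) (W2B σ) ∧
      (∀ x ∈ V2B σ, ∃ g : GB k F, g • x ∈ WB σ) ∧
      (∀ w ∈ W2B σ, ∀ w' ∈ W2B σ, (∃ g : GB k F, g • w = w') → ∃ p ∈ PB k F, p • w = w')) ∧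
    -- Case (c)
    (∀ a b c : k, c ≠ 0 → b ^ 2 + 4 * a ≠ 0 →
      (∀ p ∈ PC a b c, ∀ w ∈ WC a b c, p • w ∈ WC a b c) ∧
      EqContractedProduct (V2C a b c) (PC a b c) (W2C a b c) ∧
      (∀ x ∈ V2C a b c, ∃ g : GC a b c, g • x ∈ WC a b c) ∧
      (∀ w ∈ W2C a b c, ∀ w' ∈ W2C a b c,
        (∃ g : GC a b c, g • w = w') → ∃ p ∈ PC a b c, p • w = w')) :=
  ⟨contractedProduct_matrices, fun _ _ _ σ _ => contractedProduct_hermitian σ,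
    contractedProduct_quaternionHermitian⟩
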